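/- \textbf{Setting.} For each $n$ let $X_1,\dots,X_n$ be i.i.d. random vectors in $\mathbb R^p$ with mean $\mu$ and covariance matrix $\Sigma=(\sigma_{ij})_{1\le i,j\le p}$, and let $0\le\tau<p$ be an integer; the dimension $p$, the number $\tau$, the law of $X_1$ (hence $\mu,\Sigma$) and the underlying probability space may all depend on $n$. Put $N=\lfloor n/2\rfloor$, $\mathbf 1=(1,\dots,1)^T\in\mathbb R^p$, and for a $p\times p$ matrix $M$ let $M^{(\tau)}$ be its off-band part, $(M^{(\tau)})_{ij}=M_{ij}\,I(|i-j|\ge\tau)$. For $1\le i\le N$ let $$Y_i=(X_i-\mu)(X_i-\mu)^T,\qquad Y_{N+i}=(X_{N+i}-\mu)(X_{N+i}-\mu)^T,$$ $$Y^*_i=(X_i-\bar X^1)(X_i-\bar X^1)^T,\qquad Y^*_{N+i}=(X_{N+i}-\bar X^2)(X_{N+i}-\bar X^2)^T,$$ where $\bar X^1=\frac1N\sum_{i=1}^NX_i$ and $\bar X^2=\frac1N\sum_{i=1}^{N}X_{N+i}$. For a $p\times p$ matrix $M$ define $$e'_i(M)=\operatorname{tr}\bigl((Y_i^{(\tau)}-M^{(\tau)})(Y_{N+i}^{(\tau)}-M^{(\tau)})\bigr),\qquad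 v'_i(M)=\mathbf 1^T\bigl(Y_i^{(\tau)}+Y_{N+i}^{(\tau)}-2M^{(\tau)}\bigr)\mathbf 1,$$ $$e^{*\prime}_i(M)=\operatorname{tr}\Bigl(\bigl(Y_i^{*(\tau)}-\tfrac{N-1}NM^{(\tau)}\bigr)\bigl(Y_{N+i}^{*(\tau)}-\tfrac{N-1}NM^{(\tau)}\bigr)\Bigr),\qquad v^{*\prime}_i(M)=\mathbf 1^T\Bigl(Y_i^{*(\tau)}+Y_{N+i}^{*(\tau)}-\tfrac{2(N-1)}NM^{(\tau)}\Bigr)\mathbf 1,$$ and the empirical likelihood ratios $$L_3(M)=\sup\Bigl\{\prod_{i=1}^N(Np_i):\ p_i\ge0,\ \sum_{i=1}^Np_i=1,\ \sum_{i=1}^Np_i\,e'_i(M)=0,\ \sum_{i=1}^Np_i\,v'_i(M)=0\Bigr\},$$ and $L_4(M)$ in the same way with $e^{*\prime}_i(M),v^{*\prime}_i(M)$ in place of $e'_i(M),v'_i(M)$. Here $\sup\emptyset=0$ and $-2\log0=+\infty$. \textbf{Theorem.} Let $\delta>0$. Suppose that $\mathrm E[v_1'^2(\Sigma)]>0$ and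 $\mathrm E|e'_1(\Sigma)|^{2+\delta}<\infty$, $\mathrm E|v'_1(\Sigma)|^{2+\delta}<\infty$ for all sufficiently large $n$, and that, as $n\to\infty$, $$\max\left\{\frac{\mathrm E|e'_1(\Sigma)|^{2+\delta}}{(\mathrm E[e_1'^2(\Sigma)])^{(2+\delta)/2}},\ \frac{\mathrm E|v'_1(\Sigma)|^{2+\delta}}{(\mathrm E[v_1'^2(\Sigma)])^{(2+\delta)/2}}\right\}=o\bigl(N^{(\delta+\min\{2,\delta\})/4}\bigr).$$ Let the null hypothesis $H_0$: $\sigma_{ij}=0$ whenever $|i-j|\ge\tau$ hold (for every $n$), and let $\Sigma_0$ be any $p\times p$ matrix (possibly depending on $n$) with $\Sigma_0^{(\tau)}=0$. Then $-2\log L_3(\Sigma_0)$ converges in distribution, as $n\to\infty$, to a chi-square distribution with two degrees of freedom. If in addition the expectations on the left-hand sides below are finite for all sufficiently large $n$ and $$\mathrm E\Bigl\{\sum_{i=1}^N\bigl(e^{*\prime}_i(\Sigma)-e'_i(\Sigma)\bigr)^2+\Bigl[\sum_{i=1}^N\bigl(e^{*\prime}_i(\Sigma)-e'_i(\Sigma)\bigr)\Bigr]^2\Bigr\}=o\bigl(N\,\mathrm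 E[e_1'^2(\Sigma)]\bigr),$$ $$\mathrm E\Bigl\{\sum_{i=1}^N\bigl(v^{*\prime}_i(\Sigma)-v'_i(\Sigma)\bigr)^2+\Bigl[\sum_{i=1}^N\bigl(v^{*\prime}_i(\Sigma)-v'_i(\Sigma)\bigr)\Bigr]^2\Bigr\}=o\bigl(N\,\mathrm E[v_1'^2(\Sigma)]\bigr),$$ then $-2\log L_4(\Sigma_0)$ also converges in distribution, as $n\to\infty$, to a chi-square distribution with two degrees of freedom. -/

import Mathlib

open MeasureTheory ProbabilityTheory Filter Asymptotics
open scoped Topology ENNReal Matrix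

namespace BandedEL

noncomputable section

/-- The off-band part of a matrix: `(M^(τ))_{ij} = M_{ij}` if `|i - j| ≥ τ`, and `0` otherwise. -/
def offBand {p : ℕ} (τ : ℕ) (M : Matrix (Fin p) (Fin p) ℝ) : Matrix (Fin p) (Fin p) ℝ :=
  Matrix.of fun i j => if (τ : ℤ) ≤ |(i : ℤ) - (j : ℤ)| then M i j else 0

/-- The rank-one matrix `(x - m)(x - m)ᵀ`. -/
def outer {p : ℕ} (m x : Fin p → ℝ) : Matrix (Fin p) (Fin p) ℝ :=
  Matrix.vecMulVec (x - m) (x - m)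

/-- The sum `1ᵀ M 1` of all the entries of `M`. -/
def entrySum {p : ℕ} (M : Matrix (Fin p) (Fin p) ℝ) : ℝ :=
  (1 : Fin p → ℝ) ⬝ᵥ (M *ᵥ 1)

/-! In what follows `x : ℕ → Fin p → ℝ` is a data set whose observations are numbered from `0`.
Only the first `2 * N` of them are used: `x 0, …, x (N - 1)` form the first half of the sample and
`x N, …, x (2 * N - 1)` the second half. -/

/-- `e'_i(Σ)` for a known mean `m`. -/
def eKnown {p : ℕ} (N τ : ℕ) (m : Fin p → ℝ) (S : Matrix (Fin p) (Fin p) ℝ)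
    (x : ℕ → Fin p → ℝ) (i : ℕ) : ℝ :=
  Matrix.trace ((offBand τ (outer m (x i)) - offBand τ S) *
    (offBand τ (outer m (x (N + i))) - offBand τ S))

/-- `v'_i(Σ)` for a known mean `m`. -/
def vKnown {p : ℕ} (N τ : ℕ) (m : Fin p → ℝ) (S : Matrix (Fin p) (Fin p) ℝ)
    (x : ℕ → Fin p → ℝ) (i : ℕ) : ℝ :=
  entrySum (offBand τ (outer m (x i)) + offBand τ (outer m (x (N + i)))
    - (2 : ℝ) • offBand τ S)

/-- The mean of the first half of the sample. -/
def mean₁ {p : ℕ} (N : ℕ) (x : ℕ → Fin p → ℝ) : Fin p → ℝ :=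
  (N : ℝ)⁻¹ • ∑ i ∈ Finset.range N, x i

/-- The mean of the second half of the sample. -/
def mean₂ {p : ℕ} (N : ℕ) (x : ℕ → Fin p → ℝ) : Fin p → ℝ :=
  (N : ℝ)⁻¹ • ∑ i ∈ Finset.range N, x (N + i)

/-- `e*'_i(Σ)`, in which the mean is replaced by the means of the two half samples. -/
def eStar {p : ℕ} (N τ : ℕ) (S : Matrix (Fin p) (Fin p) ℝ)
    (x : ℕ → Fin p → ℝ) (i : ℕ) : ℝ :=
  Matrix.trace
    ((offBand τ (outer (mean₁ N x) (x i)) - (((N : ℝ) - 1) / N) • offBand τ S) *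
      (offBand τ (outer (mean₂ N x) (x (N + i))) - (((N : ℝ) - 1) / N) • offBand τ S))

/-- `v*'_i(Σ)`, in which the mean is replaced by the means of the two half samples. -/
def vStar {p : ℕ} (N τ : ℕ) (S : Matrix (Fin p) (Fin p) ℝ)
    (x : ℕ → Fin p → ℝ) (i : ℕ) : ℝ :=
  entrySum (offBand τ (outer (mean₁ N x) (x i)) + offBand τ (outer (mean₂ N x) (x (N + i)))
    - (2 * ((N : ℝ) - 1) / N) • offBand τ S)

/-- The empirical likelihood ratio of the vectors `(e i, v i)`, `i < N`: the supremum of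
`∏ (N p_i)` over all probability vectors `p` with `∑ p_i (e i, v i) = 0`. It is `0` if there is no
such `p`. -/
def elRatio (N : ℕ) (e v : ℕ → ℝ) : ℝ≥0∞ :=
  sSup {l : ℝ≥0∞ | ∃ p : Fin N → ℝ, (∀ i, 0 ≤ p i) ∧ ∑ i, p i = 1 ∧
    ∑ i, p i * e i = 0 ∧ ∑ i, p i * v i = 0 ∧ l = ENNReal.ofReal (∏ i, ((N : ℝ) * p i))}

/-- `-2 log L`, with value `+∞` at `L = 0`. -/
def negTwoLog (L : ℝ≥0∞) : EReal := (-2 : EReal) * ENNReal.log L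

/-- `L₃(Σ)`, the empirical likelihood ratio for a known mean `m`. -/
def L₃ {p : ℕ} (N τ : ℕ) (m : Fin p → ℝ) (S : Matrix (Fin p) (Fin p) ℝ)
    (x : ℕ → Fin p → ℝ) : ℝ≥0∞ :=
  elRatio N (eKnown N τ m S x) (vKnown N τ m S x)

/-- `L₄(Σ)`, the empirical likelihood ratio for an unknown mean. -/
def L₄ {p : ℕ} (N τ : ℕ) (S : Matrix (Fin p) (Fin p) ℝ) (x : ℕ → Fin p → ℝ) : ℝ≥0∞ :=
  elRatio N (eStar N τ S x) (vStar N τ S x)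

/-- For a sequence `f` of statistics and its replacement `g`, the quantity
`∑_{i<N} (g i - f i)² + (∑_{i<N} (g i - f i))²`. -/
def replError (N : ℕ) (f g : ℕ → ℝ) : ℝ :=
  ∑ i ∈ Finset.range N, (g i - f i) ^ 2 + (∑ i ∈ Finset.range N, (g i - f i)) ^ 2

/-- The chi-square distribution with `k` degrees of freedom: the law of the sum of the squares of
`k` independent standard normal variables. -/
def chiSq (k : ℕ) : Measure ℝ :=
  (Measure.pi fun _ : Fin k => gaussianReal 0 1).map fun z => ∑ i, z i ^ 2

instance (k : ℕ) : IsProbabilityMeasure (chiSq k) :=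
  Measure.isProbabilityMeasure_map
    (by fun_prop : Measurable fun z : Fin k → ℝ => ∑ i, z i ^ 2).aemeasurable

end

end BandedEL

namespace BandedEL

/-! Under the null hypothesis the off-band parts of `S` and `S₀` both vanish, so the statistics at
`S₀` are those at the true covariance. Writing `A_k(x)` for the off-band entries of `(x - μ)(x -
μ)ᵀ`, which have mean zero, one gets `e'_i = ∑ A_k(X_i) A_k(X_{N+i})` and `v'_i = ∑ A_k(X_i) + ∑
A_k(X_{N+i})`. The pairs `(X_i, X_{N+i})` are i.i.d., so whatever the dimension only a bivariate
triangular array with i.i.d. rows matters. Its entries are centred, and they are uncorrelated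
because integrating `e'_i` in one variable with the other fixed gives zero. If `e'_i` vanished
almost surely, every `A_k` would vanish and `v'_i` with it, so both variances are positive
(`moments_eKnown_vKnown`).

The likelihood ratio is invariant under rescaling, so both coordinates may be standardized. The
moment condition then gives Lyapunov's condition: normalized sums are asymptotically standard normal
in the plane, the matrix of second moments tends to the identity, and the maximum is `o(√N)`
(`StandardArray.of_lyapunovArray`).

The deterministic core is `exists_negTwoLog_elRatio`: under these three properties `-2 log L` is
close to the squared norm of the normalized sum. The Lagrange multiplier equation is never solved.
Weak duality at an explicit multiplier bounds `L` above, and explicit weights, affine in the data,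
bound it below; the same weights show that the constraints are feasible. The chi-square limit
follows by Slutsky's lemma.

For unknown means, the replacement conditions and Markov's inequality show that the standardized
perturbation is small in quadratic mean and in sum, which preserves all properties used
(`StandardArray.of_replError`). -/

/-! ### Deterministic expansion of the empirical likelihood ratio. -/

/-- Second order expansion of `log (1 + x)` with a relative error. -/
lemma abs_log_one_add_sub_le {x η : ℝ} (hη : η ≤ 1 / 5) (hx : |x| ≤ η) :
    |Real.log (1 + x) - (x - x ^ 2 / 2)| ≤ 2 * η * x ^ 2 := by
  have h1 : |-x| < 1 := by rw [abs_neg]; linarith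
  have h := Real.abs_log_sub_add_sum_range_le h1 2
  simp only [Finset.sum_range_succ, Finset.sum_range_zero, abs_neg] at h
  have h2 : |x| ^ (2 + 1) / (1 - |x|) ≤ 2 * η * x ^ 2 := by
    rw [div_le_iff₀ (by linarith), ← sq_abs x]
    have h0 := abs_nonneg x
    -- It is enough that `2 * (1 - |x|) ≥ 1`. The bound `1 / 5` on `η` leaves room for a later
    -- application at `2 * η` with `η ≤ 1 / 10`.
    have h3 : |x| ≤ 2 * η * (1 - |x|) := by nlinarith
    calc |x| ^ (2 + 1) = |x| ^ 2 * |x| := by ring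
      _ ≤ |x| ^ 2 * (2 * η * (1 - |x|)) := mul_le_mul_of_nonneg_left h3 (sq_nonneg |x|)
      _ = 2 * η * |x| ^ 2 * (1 - |x|) := by ring
  refine le_trans (le_of_eq ?_) (h.trans h2)
  congr 1
  rw [sub_neg_eq_add]
  norm_num
  ring

/-- The empirical likelihood ratio is bounded above by the dual objective function. -/
lemma elRatio_le_of_dual {N : ℕ} {e v : ℕ → ℝ} {l₁ l₂ : ℝ}
    (hpos : ∀ i < N, 0 < 1 + (l₁ * e i + l₂ * v i)) :
    elRatio N e v ≤ ENNReal.ofReal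
      (Real.exp (-∑ i ∈ Finset.range N, Real.log (1 + (l₁ * e i + l₂ * v i)))) := by
  refine sSup_le ?_
  rintro _ ⟨p, hp0, hp1, hpe, hpv, rfl⟩
  apply ENNReal.ofReal_le_ofReal
  have hposi : ∀ i : Fin N, 0 < 1 + (l₁ * e i + l₂ * v i) := fun i => hpos i i.2
  have hN : ∑ _i : Fin N, (1 : ℝ) = N := by simp
  -- Weak duality, for any admissible multiplier: `y ≤ exp (y - 1)` for each factor, and the
  -- constraints force the factors to sum to `N`.
  have key : ∏ i : Fin N, ((N : ℝ) * p i * (1 + (l₁ * e i + l₂ * v i))) ≤ 1 := by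
    calc ∏ i : Fin N, ((N : ℝ) * p i * (1 + (l₁ * e i + l₂ * v i)))
        ≤ ∏ i : Fin N, Real.exp ((N : ℝ) * p i * (1 + (l₁ * e i + l₂ * v i)) - 1) := by
          refine Finset.prod_le_prod (fun i _ => ?_) (fun i _ => ?_)
          · exact mul_nonneg (mul_nonneg (by positivity) (hp0 i)) (hposi i).le
          · have := Real.add_one_le_exp ((N : ℝ) * p i * (1 + (l₁ * e i + l₂ * v i)) - 1)
            linarith
      _ = 1 := by
          rw [← Real.exp_sum, Finset.sum_sub_distrib, hN]
          have : ∑ i : Fin N, (N : ℝ) * p i * (1 + (l₁ * e i + l₂ * v i))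
              = N * (∑ i, p i + l₁ * ∑ i, p i * e i + l₂ * ∑ i, p i * v i) := by
            rw [Finset.mul_sum, Finset.mul_sum, ← Finset.sum_add_distrib,
              ← Finset.sum_add_distrib, Finset.mul_sum]
            exact Finset.sum_congr rfl fun i _ => by ring
          rw [this, hp1, hpe, hpv]
          simp
  rw [Finset.prod_mul_distrib] at key
  rw [Real.exp_neg, Real.exp_sum, Finset.prod_range]
  have hprod : 0 < ∏ i : Fin N, Real.exp (Real.log (1 + (l₁ * e i + l₂ * v i))) :=
    Finset.prod_pos fun i _ => Real.exp_pos _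
  rw [← one_div, le_div_iff₀ hprod]
  refine le_trans (le_of_eq ?_) key
  congr 1
  exact Finset.prod_congr rfl fun i _ => Real.exp_log (hposi i)

/-- A lower bound for the empirical likelihood ratio from explicit weights. -/
lemma le_elRatio {N : ℕ} {e v : ℕ → ℝ} {l₁ l₂ q : ℝ} (hN : 0 < N) (hq : q < 1)
    (hx : ∀ i < N, l₁ * e i + l₂ * v i < 1)
    (hqsum : ∑ i ∈ Finset.range N, (l₁ * e i + l₂ * v i) = N * q)
    (he : ∑ i ∈ Finset.range N, (l₁ * e i + l₂ * v i) * e i = ∑ i ∈ Finset.range N, e i)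
    (hv : ∑ i ∈ Finset.range N, (l₁ * e i + l₂ * v i) * v i = ∑ i ∈ Finset.range N, v i) :
    ENNReal.ofReal (Real.exp (∑ i ∈ Finset.range N, Real.log (1 - (l₁ * e i + l₂ * v i))
      - N * Real.log (1 - q))) ≤ elRatio N e v := by
  have hN' : (N : ℝ) ≠ 0 := by positivity
  have hq' : 0 < 1 - q := by linarith
  -- The optimal weights are proportional to `1 / (1 + x_i)`; their linearization `1 - x_i` turns
  -- the constraints into linear equations for `l₁, l₂` that can be solved exactly.
  refine le_sSup ⟨fun i => (1 - (l₁ * e i + l₂ * v i)) / (N * (1 - q)), fun i => ?_, ?_, ?_, ?_,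
    ?_⟩
  · exact div_nonneg (by linarith [hx i i.2]) (by positivity)
  · rw [← Finset.sum_div, ← Finset.sum_range fun i : ℕ => 1 - (l₁ * e i + l₂ * v i),
      Finset.sum_sub_distrib, hqsum]
    simp only [Finset.sum_const, Finset.card_range, nsmul_eq_mul]
    field_simp
  · rw [← Finset.sum_range fun i : ℕ => (1 - (l₁ * e i + l₂ * v i)) / (N * (1 - q)) * e i]
    have : ∀ i, (1 - (l₁ * e i + l₂ * v i)) / (N * (1 - q)) * e i
        = (e i - (l₁ * e i + l₂ * v i) * e i) / (N * (1 - q)) := fun i => by ring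
    simp_rw [this]
    rw [← Finset.sum_div, Finset.sum_sub_distrib, he, sub_self, zero_div]
  · rw [← Finset.sum_range fun i : ℕ => (1 - (l₁ * e i + l₂ * v i)) / (N * (1 - q)) * v i]
    have : ∀ i, (1 - (l₁ * e i + l₂ * v i)) / (N * (1 - q)) * v i
        = (v i - (l₁ * e i + l₂ * v i) * v i) / (N * (1 - q)) := fun i => by ring
    simp_rw [this]
    rw [← Finset.sum_div, Finset.sum_sub_distrib, hv, sub_self, zero_div]
  · congr 1
    rw [← Finset.prod_range fun i : ℕ =>
      (N : ℝ) * ((1 - (l₁ * e i + l₂ * v i)) / (N * (1 - q)))]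
    have h1 : (N : ℝ) * Real.log (1 - q) = ∑ i ∈ Finset.range N, Real.log (1 - q) := by simp
    rw [h1, ← Finset.sum_sub_distrib, Real.exp_sum]
    refine Finset.prod_congr rfl fun i hi => ?_
    have hi' := hx i (Finset.mem_range.1 hi)
    rw [← Real.log_div (by linarith) hq'.ne', Real.exp_log (div_pos (by linarith) hq')]
    field_simp

lemma negTwoLog_ofReal_exp (t : ℝ) :
    negTwoLog (ENNReal.ofReal (Real.exp t)) = ((-2 * t : ℝ) : EReal) := by
  rw [negTwoLog, ENNReal.log_ofReal_of_pos (Real.exp_pos _), Real.log_exp, EReal.coe_mul]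
  rfl

lemma negTwoLog_antitone : Antitone negTwoLog := by
  intro a b hab
  have h := ENNReal.log_le_log hab
  rw [negTwoLog, negTwoLog]
  have h2 : ∀ x : EReal, (-2 : EReal) * x = -(2 * x) := fun x => by
    rw [EReal.neg_mul]
  rw [h2, h2, EReal.neg_le_neg_iff]
  exact mul_le_mul_of_nonneg_left h (by norm_num)

lemma measurable_negTwoLog : Measurable negTwoLog :=
  negTwoLog_antitone.measurable

set_option maxHeartbeats 1000000 in
/-- **Wilks expansion of the empirical likelihood ratio.** If the second moments of the data are
close to the identity and the data are small relative to their mean, then `-2 log L` is close to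
the squared norm of the normalized mean. -/
theorem exists_negTwoLog_elRatio {N : ℕ} (hN : 0 < N) {e v : ℕ → ℝ} {η M : ℝ} (hη : η ≤ 1 / 10)
    (he : ∀ i < N, |e i| ≤ M) (hv : ∀ i < N, |v i| ≤ M)
    {m₁ m₂ a b c : ℝ}
    (hm₁ : ∑ i ∈ Finset.range N, e i = N * m₁) (hm₂ : ∑ i ∈ Finset.range N, v i = N * m₂)
    (ha : ∑ i ∈ Finset.range N, e i ^ 2 = N * a) (hb : ∑ i ∈ Finset.range N, e i * v i = N * b)
    (hc : ∑ i ∈ Finset.range N, v i ^ 2 = N * c)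
    (ha1 : |a - 1| ≤ η) (hb1 : |b| ≤ η) (hc1 : |c - 1| ≤ η)
    (hM : M * (|m₁| + |m₂|) ≤ η) :
    ∃ r : ℝ, negTwoLog (elRatio N e v) = r ∧
      |r - N * (m₁ ^ 2 + m₂ ^ 2)| ≤ 17 * η * (N * (m₁ ^ 2 + m₂ ^ 2)) := by
  have hη0 : 0 ≤ η := (abs_nonneg _).trans hb1
  have hM0 : 0 ≤ M := (abs_nonneg _).trans (he 0 hN)
  rw [abs_le] at ha1 hb1 hc1
  set W : ℝ := m₁ ^ 2 + m₂ ^ 2 with hW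
  have hW0 : 0 ≤ W := by positivity
  have hNr : (0 : ℝ) < N := by positivity
  have hxbound : ∀ l₁ l₂ K : ℝ, |l₁| + |l₂| ≤ K * (|m₁| + |m₂|) → 0 ≤ K → ∀ i < N,
      |l₁ * e i + l₂ * v i| ≤ K * η := by
    intro l₁ l₂ K hl hK i hi
    calc |l₁ * e i + l₂ * v i| ≤ |l₁| * |e i| + |l₂| * |v i| := by
          rw [← abs_mul, ← abs_mul]; exact abs_add_le _ _
      _ ≤ |l₁| * M + |l₂| * M := by gcongr <;> solve_by_elim
      _ = M * (|l₁| + |l₂|) := by ring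
      _ ≤ M * (K * (|m₁| + |m₂|)) := by gcongr
      _ = K * (M * (|m₁| + |m₂|)) := by ring
      _ ≤ K * η := by gcongr
  have hxsum : ∀ l₁ l₂ : ℝ, ∑ i ∈ Finset.range N, (l₁ * e i + l₂ * v i)
      = N * (l₁ * m₁ + l₂ * m₂) := by
    intro l₁ l₂
    rw [Finset.sum_add_distrib, ← Finset.mul_sum, ← Finset.mul_sum, hm₁, hm₂]; ring
  have hxsq : ∀ l₁ l₂ : ℝ, ∑ i ∈ Finset.range N, (l₁ * e i + l₂ * v i) ^ 2
      = N * (l₁ ^ 2 * a + 2 * (l₁ * l₂) * b + l₂ ^ 2 * c) := by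
    intro l₁ l₂
    have : ∀ i, (l₁ * e i + l₂ * v i) ^ 2
        = l₁ ^ 2 * e i ^ 2 + 2 * (l₁ * l₂) * (e i * v i) + l₂ ^ 2 * v i ^ 2 := fun i => by ring
    simp_rw [this]
    rw [Finset.sum_add_distrib, Finset.sum_add_distrib, ← Finset.mul_sum, ← Finset.mul_sum,
      ← Finset.mul_sum, ha, hb, hc]
    ring
  -- the upper bound for the likelihood ratio
  have hlow : ((((1 - 17 * η) * (N * W) : ℝ)) : EReal) ≤ negTwoLog (elRatio N e v) := by
    -- Any multiplier gives a bound. As the second moments are close to the identity, the mean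
    -- itself is close enough to the optimal one.
    have hx := hxbound m₁ m₂ 1 (by simp) zero_le_one
    simp only [one_mul] at hx
    have hd := elRatio_le_of_dual (N := N) (e := e) (v := v) (l₁ := m₁) (l₂ := m₂)
      (fun i hi => by have := abs_le.1 (hx i hi); linarith [this.1])
    refine le_trans ?_ (negTwoLog_antitone hd)
    rw [negTwoLog_ofReal_exp, EReal.coe_le_coe_iff]
    have h1 : ∑ i ∈ Finset.range N, ((m₁ * e i + m₂ * v i)
        - (1 / 2 + 2 * η) * (m₁ * e i + m₂ * v i) ^ 2)
        ≤ ∑ i ∈ Finset.range N, Real.log (1 + (m₁ * e i + m₂ * v i)) := by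
      refine Finset.sum_le_sum fun i hi => ?_
      have := (abs_le.1 (abs_log_one_add_sub_le (by linarith) (hx i (Finset.mem_range.1 hi)))).1
      linarith
    rw [Finset.sum_sub_distrib, ← Finset.mul_sum, hxsum, hxsq] at h1
    have h2 : m₁ ^ 2 * a + 2 * (m₁ * m₂) * b + m₂ ^ 2 * c ≤ (1 + 2 * η) * W := by
      have h3 : 2 * (m₁ * m₂) * b ≤ η * W := by
        rcases le_total 0 (m₁ * m₂) with h | h
        · nlinarith [sq_nonneg (m₁ - m₂), sq_nonneg (m₁ + m₂)]
        · nlinarith [sq_nonneg (m₁ - m₂), sq_nonneg (m₁ + m₂)]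
      nlinarith [sq_nonneg m₁, sq_nonneg m₂]
    have h4 : (1 / 2 + 2 * η) * (N * (m₁ ^ 2 * a + 2 * (m₁ * m₂) * b + m₂ ^ 2 * c))
        ≤ (1 / 2 + 17 / 2 * η) * (N * W) := by
      calc (1 / 2 + 2 * η) * (N * (m₁ ^ 2 * a + 2 * (m₁ * m₂) * b + m₂ ^ 2 * c))
          ≤ (1 / 2 + 2 * η) * (N * ((1 + 2 * η) * W)) := by gcongr
        _ = ((1 / 2 + 2 * η) * (1 + 2 * η)) * (N * W) := by ring
        _ ≤ (1 / 2 + 17 / 2 * η) * (N * W) := by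
            refine mul_le_mul_of_nonneg_right ?_ (by positivity)
            nlinarith
    have h5 : (N : ℝ) * (m₁ * m₁ + m₂ * m₂) = N * W := by rw [hW]; ring
    linarith
  -- the lower bound for the likelihood ratio
  have hup : negTwoLog (elRatio N e v) ≤ ((((1 + 17 * η) * (N * W) : ℝ)) : EReal) := by
    set D : ℝ := a * c - b ^ 2 with hD
    have hbsq : b ^ 2 ≤ η ^ 2 := by nlinarith
    have hDη : 1 - 2 * η ≤ D := by
      have : (1 - η) * (1 - η) ≤ a * c :=
        mul_le_mul (by linarith) (by linarith) (by linarith) (by linarith)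
      nlinarith
    have hD0 : 0 < D := by linarith
    -- Cramer's rule for `l = S⁻¹ m`, where `S` is the second moment matrix with rows `(a, b)` and
    -- `(b, c)`.
    set l₁ : ℝ := (c * m₁ - b * m₂) / D with hl₁
    set l₂ : ℝ := (a * m₂ - b * m₁) / D with hl₂
    have hS₁ : l₁ * a + l₂ * b = m₁ := by
      rw [hl₁, hl₂]; field_simp; rw [hD]; ring
    have hS₂ : l₁ * b + l₂ * c = m₂ := by
      rw [hl₁, hl₂]; field_simp; rw [hD]; ring
    set q : ℝ := l₁ * m₁ + l₂ * m₂ with hq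
    -- For `η ≤ 1 / 10` the entries give a factor at most `11/10 + 1/10`, and `D ≥ 8/10`, so even
    -- `3/2` would do.
    have hl : |l₁| + |l₂| ≤ 2 * (|m₁| + |m₂|) := by
      have hb' : |b| ≤ 1 / 10 := abs_le.2 ⟨by linarith, by linarith⟩
      have hc' : |c| ≤ 11 / 10 := abs_le.2 ⟨by linarith, by linarith⟩
      have ha' : |a| ≤ 11 / 10 := abs_le.2 ⟨by linarith, by linarith⟩
      rw [hl₁, hl₂, abs_div, abs_div, ← add_div, abs_of_pos hD0, div_le_iff₀ hD0]
      have e1 : |c * m₁ - b * m₂| ≤ |c| * |m₁| + |b| * |m₂| := by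
        rw [← abs_mul, ← abs_mul]; exact abs_sub _ _
      have e2 : |a * m₂ - b * m₁| ≤ |a| * |m₂| + |b| * |m₁| := by
        rw [← abs_mul, ← abs_mul]; exact abs_sub _ _
      have e3 := mul_le_mul_of_nonneg_right hc' (abs_nonneg m₁)
      have e4 := mul_le_mul_of_nonneg_right hb' (abs_nonneg m₂)
      have e5 := mul_le_mul_of_nonneg_right ha' (abs_nonneg m₂)
      have e6 := mul_le_mul_of_nonneg_right hb' (abs_nonneg m₁)
      have e7 : 2 * (|m₁| + |m₂|) * (8 / 10) ≤ 2 * (|m₁| + |m₂|) * D :=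
        mul_le_mul_of_nonneg_left (by linarith) (by positivity)
      linarith [abs_nonneg m₁, abs_nonneg m₂]
    have hx := hxbound l₁ l₂ 2 hl (by norm_num)
    have hqsum := hxsum l₁ l₂
    -- Since `S l = m`, the quadratic form `lᵀ S l` equals `lᵀ m`: the `x_i` and their squares have
    -- the same sum `N * q`.
    have hsq : ∑ i ∈ Finset.range N, (l₁ * e i + l₂ * v i) ^ 2 = N * q := by
      rw [hxsq, hq]
      have : l₁ ^ 2 * a + 2 * (l₁ * l₂) * b + l₂ ^ 2 * c
          = l₁ * (l₁ * a + l₂ * b) + l₂ * (l₁ * b + l₂ * c) := by ring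
      rw [this, hS₁, hS₂]
    have hq0 : 0 ≤ q := by
      have h : 0 ≤ (N : ℝ) * q := by rw [← hsq]; positivity
      exact nonneg_of_mul_nonneg_right h hNr
    have hq1 : q ≤ 2 * η := by
      have h : (N : ℝ) * q ≤ N * (2 * η) := by
        rw [← hqsum]
        refine (Finset.sum_le_sum fun i hi =>
          (le_abs_self _).trans (hx i (Finset.mem_range.1 hi))).trans ?_
        simp
      exact le_of_mul_le_mul_left h hNr
    have hqW : q ≤ (1 + 5 * η) * W := by
      have h1 : q = (c * m₁ ^ 2 - 2 * b * (m₁ * m₂) + a * m₂ ^ 2) / D := by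
        rw [hq, hl₁, hl₂]; field_simp; ring
      have h3 : -(2 * b * (m₁ * m₂)) ≤ η * W := by
        rcases le_total 0 (m₁ * m₂) with h | h
        · nlinarith [sq_nonneg (m₁ - m₂), sq_nonneg (m₁ + m₂)]
        · nlinarith [sq_nonneg (m₁ - m₂), sq_nonneg (m₁ + m₂)]
      have h2 : c * m₁ ^ 2 - 2 * b * (m₁ * m₂) + a * m₂ ^ 2 ≤ (1 + 2 * η) * W := by
        nlinarith [sq_nonneg m₁, sq_nonneg m₂]
      rw [h1, div_le_iff₀ hD0]
      calc c * m₁ ^ 2 - 2 * b * (m₁ * m₂) + a * m₂ ^ 2 ≤ (1 + 2 * η) * W := h2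
        -- This amounts to `10 * η ^ 2 ≤ η`, that is, `η ≤ 1 / 10`.
        _ ≤ ((1 + 5 * η) * (1 - 2 * η)) * W := by
            refine mul_le_mul_of_nonneg_right ?_ hW0; nlinarith
        _ = (1 + 5 * η) * W * (1 - 2 * η) := by ring
        _ ≤ (1 + 5 * η) * W * D := by gcongr
    have hd := le_elRatio (N := N) (e := e) (v := v) (l₁ := l₁) (l₂ := l₂) (q := q) hN
      (by linarith)
      (fun i hi => by have := (abs_le.1 (hx i hi)).2; linarith)
      hqsum
      (by
        have : ∀ i, (l₁ * e i + l₂ * v i) * e i = l₁ * e i ^ 2 + l₂ * (e i * v i) :=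
          fun i => by ring
        simp_rw [this]
        rw [Finset.sum_add_distrib, ← Finset.mul_sum, ← Finset.mul_sum, ha, hb, hm₁, ← hS₁]
        ring)
      (by
        have : ∀ i, (l₁ * e i + l₂ * v i) * v i = l₁ * (e i * v i) + l₂ * v i ^ 2 :=
          fun i => by ring
        simp_rw [this]
        rw [Finset.sum_add_distrib, ← Finset.mul_sum, ← Finset.mul_sum, hc, hb, hm₂, ← hS₂]
        ring)
    refine (negTwoLog_antitone hd).trans ?_
    rw [negTwoLog_ofReal_exp, EReal.coe_le_coe_iff]
    have h1 : ∑ i ∈ Finset.range N, (-(l₁ * e i + l₂ * v i)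
        - (1 / 2 + 4 * η) * (l₁ * e i + l₂ * v i) ^ 2)
        ≤ ∑ i ∈ Finset.range N, Real.log (1 - (l₁ * e i + l₂ * v i)) := by
      refine Finset.sum_le_sum fun i hi => ?_
      have hxi : |-(l₁ * e i + l₂ * v i)| ≤ 2 * η := by
        rw [abs_neg]; exact hx i (Finset.mem_range.1 hi)
      have := (abs_le.1 (abs_log_one_add_sub_le (by linarith) hxi)).1
      rw [← sub_eq_add_neg] at this
      linarith
    rw [Finset.sum_sub_distrib, ← Finset.mul_sum, hsq, Finset.sum_neg_distrib, hqsum] at h1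
    -- The normalization of the weights cancels the first order term `∑ x_i = N * q`; only the
    -- quadratic term survives.
    have h2 : (N : ℝ) * Real.log (1 - q) ≤ N * (-q) := by
      refine mul_le_mul_of_nonneg_left ?_ hNr.le
      have := Real.log_le_sub_one_of_pos (x := 1 - q) (by linarith)
      linarith
    have h3 : (1 + 8 * η) * (N * q) ≤ (1 + 17 * η) * (N * W) := by
      calc (1 + 8 * η) * (N * q) ≤ (1 + 8 * η) * (N * ((1 + 5 * η) * W)) := by gcongr
        _ = ((1 + 8 * η) * (1 + 5 * η)) * (N * W) := by ring
        -- Here the constant 17 originates: the product is `1 + 13 * η + 40 * η ^ 2`, and `40 * η ^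
        -- 2 ≤ 4 * η`.
        _ ≤ (1 + 17 * η) * (N * W) := by
            refine mul_le_mul_of_nonneg_right ?_ (by positivity)
            nlinarith
    linarith
  have hbot : negTwoLog (elRatio N e v) ≠ ⊥ := fun h => by
    rw [h] at hlow; exact EReal.coe_ne_bot _ (le_bot_iff.1 hlow)
  have htop : negTwoLog (elRatio N e v) ≠ ⊤ := fun h => by
    rw [h] at hup; exact EReal.coe_ne_top _ (top_le_iff.1 hup)
  refine ⟨(negTwoLog (elRatio N e v)).toReal, (EReal.coe_toReal htop hbot).symm, ?_⟩
  rw [← EReal.coe_toReal htop hbot, EReal.coe_le_coe_iff] at hlow hup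
  rw [abs_le]
  constructor <;> linarith

/-! ### Scale invariance and measurability of the likelihood ratio. -/

/-- The empirical likelihood ratio is invariant under rescaling of the data. -/
lemma elRatio_const_mul {N : ℕ} {e v : ℕ → ℝ} {s t : ℝ} (hs : s ≠ 0) (ht : t ≠ 0) :
    elRatio N (fun i => s * e i) (fun i => t * v i) = elRatio N e v := by
  have h : ∀ (p : Fin N → ℝ) (s : ℝ) (e : ℕ → ℝ), s ≠ 0 →
      (∑ i, p i * (s * e i) = 0 ↔ ∑ i, p i * e i = 0) := by
    intro p s e hs
    have : ∑ i, p i * (s * e i) = s * ∑ i, p i * e i := by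
      rw [Finset.mul_sum]; exact Finset.sum_congr rfl fun i _ => by ring
    rw [this, mul_eq_zero, or_iff_right hs]
  simp only [elRatio, h _ _ _ hs, h _ _ _ ht]

/-- The empirical likelihood ratio as a function of finitely many data is Borel. -/
lemma measurable_elRatio {N : ℕ} :
    Measurable fun z : (ℕ → ℝ) × (ℕ → ℝ) => elRatio N z.1 z.2 := by
  -- For `y ≠ 0` the set `{y ≤ L}` is the projection, along the compact simplex, of a closed set: a
  -- nonempty feasible set is compact, so the supremum is attained. An empty one has `L = 0`, which
  -- is why `y = 0` is separated.
  refine UpperSemicontinuous.measurable ?_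
  rw [upperSemicontinuous_iff_isClosed_preimage]
  intro y
  rcases eq_or_ne y 0 with rfl | hy
  · simp
  have hcont : Continuous fun p : Fin N → ℝ => ENNReal.ofReal (∏ i, ((N : ℝ) * p i)) := by
    exact ENNReal.continuous_ofReal.comp (by fun_prop)
  let K : Set ((Fin N → ℝ) × ((ℕ → ℝ) × (ℕ → ℝ))) := {w | ∑ i, w.1 i * w.2.1 i = 0 ∧
    ∑ i, w.1 i * w.2.2 i = 0 ∧ y ≤ ENNReal.ofReal (∏ i, ((N : ℝ) * w.1 i))}
  have hK : IsClosed K := by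
    refine (isClosed_eq (by fun_prop) continuous_const).inter
      ((isClosed_eq (by fun_prop) continuous_const).inter
        (isClosed_le continuous_const (hcont.comp continuous_fst)))
  have : CompactSpace (stdSimplex ℝ (Fin N)) :=
    isCompact_iff_compactSpace.1 (isCompact_stdSimplex ℝ (Fin N))
  have hproj : IsClosed (Prod.snd '' ((fun w : stdSimplex ℝ (Fin N) × ((ℕ → ℝ) × (ℕ → ℝ)) =>
      ((w.1 : Fin N → ℝ), w.2)) ⁻¹' K)) :=
    isClosedMap_snd_of_compactSpace _ (hK.preimage (by fun_prop))
  convert! hproj using 1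
  ext z
  simp only [Set.mem_preimage, Set.mem_Ici, Set.mem_image, Prod.exists, exists_eq_right]
  constructor
  · intro hz
    let F : Set (Fin N → ℝ) := stdSimplex ℝ (Fin N) ∩ {p | ∑ i, p i * z.1 i = 0 ∧
      ∑ i, p i * z.2 i = 0}
    have hF : IsCompact F := (isCompact_stdSimplex ℝ (Fin N)).inter_right
      ((isClosed_eq (by fun_prop) continuous_const).inter
        (isClosed_eq (by fun_prop) continuous_const))
    have hset : elRatio N z.1 z.2 =
        sSup ((fun p : Fin N → ℝ => ENNReal.ofReal (∏ i, ((N : ℝ) * p i))) '' F) := by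
      rw [elRatio]
      congr 1
      ext l
      constructor
      · rintro ⟨p, h0, h1, h2, h3, rfl⟩
        exact ⟨p, ⟨⟨h0, h1⟩, h2, h3⟩, rfl⟩
      · rintro ⟨p, ⟨⟨h0, h1⟩, h2, h3⟩, rfl⟩
        exact ⟨p, h0, h1, h2, h3, rfl⟩
    rcases F.eq_empty_or_nonempty with hFe | hFn
    · rw [hset, hFe] at hz
      simp only [Set.image_empty, sSup_empty, bot_eq_zero', nonpos_iff_eq_zero] at hz
      exact absurd hz hy
    · obtain ⟨p, ⟨hp, hp1, hp2⟩, hpl⟩ := (hF.image hcont).sSup_mem (hFn.image _)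
      refine ⟨⟨p, hp⟩, hp1, hp2, ?_⟩
      rw [← hset] at hpl
      exact hz.trans hpl.ge
  · rintro ⟨p, h1, h2, h3⟩
    exact h3.trans (le_sSup ⟨p, p.2.1, p.2.2, h1, h2, rfl⟩)

lemma elRatio_congr {N : ℕ} {e e' v v' : ℕ → ℝ} (he : ∀ i < N, e i = e' i)
    (hv : ∀ i < N, v i = v' i) : elRatio N e v = elRatio N e' v' := by
  have h1 : ∀ i : Fin N, e i = e' i := fun i => he i i.2
  have h2 : ∀ i : Fin N, v i = v' i := fun i => hv i i.2
  simp only [elRatio, h1, h2]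

/-- Measurability of the empirical likelihood statistic of random data. -/
lemma aemeasurable_negTwoLog_elRatio {Ω : Type*} [MeasurableSpace Ω] {P : Measure Ω} {N : ℕ}
    {e v : ℕ → Ω → ℝ} (he : ∀ i < N, AEMeasurable (e i) P) (hv : ∀ i < N, AEMeasurable (v i) P) :
    AEMeasurable (fun ω => negTwoLog (elRatio N (fun i => e i ω) (fun i => v i ω))) P := by
  -- Nothing is known about the entries beyond `N`; replacing them by `0` leaves the ratio
  -- unchanged.
  have h : ∀ {u : ℕ → Ω → ℝ}, (∀ i < N, AEMeasurable (u i) P) →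
      AEMeasurable (fun ω i => if i < N then u i ω else 0) P := by
    intro u hu
    refine aemeasurable_pi_lambda _ fun i => ?_
    by_cases hi : i < N
    · simpa [hi] using hu i hi
    · simp [hi]
  have := (measurable_negTwoLog.comp (measurable_elRatio (N := N))).comp_aemeasurable ((h he).prodMk (h hv))
  refine this.congr (ae_of_all _ fun ω => ?_)
  simp only [Function.comp_apply]
  congr 1
  exact elRatio_congr (fun i hi => by simp [hi]) (fun i hi => by simp [hi])

/-! ### Events of probability tending to one. -/

section WHP

variable {Ω : ℕ → Type*} [∀ n, MeasurableSpace (Ω n)]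

/-- The events `q n` have probability tending to one. -/
def WHP (P : ∀ n, Measure (Ω n)) (q : ∀ n, Ω n → Prop) : Prop :=
  Tendsto (fun n => P n {ω | ¬ q n ω}) atTop (𝓝 0)

variable {P : ∀ n, Measure (Ω n)} {q r : ∀ n, Ω n → Prop}

/-- This calculus rests only on monotonicity and subadditivity of the measure, so the events need
not be measurable. -/
lemma WHP.of_le {u : ℕ → ℝ≥0∞} (hu : Tendsto u atTop (𝓝 0))
    (h : ∀ᶠ n in atTop, P n {ω | ¬ q n ω} ≤ u n) : WHP P q :=
  tendsto_of_tendsto_of_tendsto_of_le_of_le' tendsto_const_nhds hu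
    (Eventually.of_forall fun _ => zero_le) h

lemma WHP.mono (hq : WHP P q) (h : ∀ᶠ n in atTop, ∀ ω, q n ω → r n ω) : WHP P r :=
  WHP.of_le hq (h.mono fun _ hn => measure_mono fun ω hr hq' => hr (hn ω hq'))

lemma WHP.and (hq : WHP P q) (hr : WHP P r) : WHP P fun n ω => q n ω ∧ r n ω := by
  refine WHP.of_le (by simpa using Tendsto.add hq hr) (Eventually.of_forall fun n => ?_)
  refine le_trans (measure_mono ?_) (measure_union_le _ _)
  intro ω hω
  simp only [Set.mem_ofPred_eq, not_and_or] at hω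
  exact hω

/-- To have high probability it suffices to have it up to an arbitrarily small error. -/
lemma WHP.of_forall_le {C : ℝ} (h : ∀ κ : ℝ, 0 < κ → κ ≤ 1 →
    ∀ᶠ n in atTop, P n {ω | ¬ q n ω} ≤ ENNReal.ofReal (C * κ)) : WHP P q := by
  rw [WHP, ENNReal.tendsto_nhds_zero]
  intro ε hε
  obtain ⟨x, hx0, hx⟩ := ENNReal.lt_iff_exists_real_btwn.1 hε
  have hxpos : 0 < x := by simpa using hx.1
  have hκ : 0 < min 1 (x / (|C| + 1)) := by positivity
  refine (h _ hκ (min_le_left _ _)).mono fun n hn => hn.trans (le_trans ?_ hx.2.le)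
  apply ENNReal.ofReal_le_ofReal
  calc C * min 1 (x / (|C| + 1)) ≤ (|C| + 1) * (x / (|C| + 1)) :=
        mul_le_mul (by linarith [le_abs_self C]) (min_le_right _ _) hκ.le (by positivity)
    _ = x := by field_simp

end WHP

/-! ### Convergence in distribution on varying probability spaces. -/

section Distribution

variable {Ω : ℕ → Type*} [∀ n, MeasurableSpace (Ω n)] {P : ∀ n, Measure (Ω n)}
  [∀ n, IsProbabilityMeasure (P n)] {Ω' : Type*} [MeasurableSpace Ω'] {P' : Measure Ω'}
  [IsProbabilityMeasure P'] {E : Type*} [MeasurableSpace E]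

/-- Convergence in distribution depends on the laws only. -/
lemma tendstoInDistribution_of_map_eq [TopologicalSpace E] [OpensMeasurableSpace E]
    {Ω₁ : ℕ → Type*} [∀ n, MeasurableSpace (Ω₁ n)] {P₁ : ∀ n, Measure (Ω₁ n)}
    [∀ n, IsProbabilityMeasure (P₁ n)] {Ω₁' : Type*} [MeasurableSpace Ω₁'] {P₁' : Measure Ω₁'}
    [IsProbabilityMeasure P₁']
    {X : ∀ n, Ω n → E} {Y : ∀ n, Ω₁ n → E} {Z : Ω' → E} {Z₁ : Ω₁' → E}
    (hX : TendstoInDistribution X atTop Z P P') (hY : ∀ n, AEMeasurable (Y n) (P₁ n))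
    (hZ₁ : AEMeasurable Z₁ P₁')
    (h : ∀ n, (P₁ n).map (Y n) = (P n).map (X n)) (h' : P₁'.map Z₁ = P'.map Z) :
    TendstoInDistribution Y atTop Z₁ P₁ P₁' := by
  refine ⟨hY, hZ₁, ?_⟩
  have := hX.tendsto
  simp only [h, h']
  exact this

/-- **Slutsky's lemma** for random variables on varying probability spaces. -/
lemma tendstoInDistribution_of_whp_sub [NormedAddCommGroup E] [SecondCountableTopology E]
    [BorelSpace E] {X Y : ∀ n, Ω n → E} {Z : Ω' → E}
    (hX : TendstoInDistribution X atTop Z P P') (hY : ∀ n, AEMeasurable (Y n) (P n))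
    (hXY : ∀ ε > 0, WHP P fun n ω => ‖Y n ω - X n ω‖ < ε) :
    TendstoInDistribution Y atTop Z P P' := by
  -- All variables are lifted to the product of the spaces: evaluation preserves each law, and
  -- Slutsky's lemma on a single space applies there.
  have hev := measurePreserving_eval_infinitePi P
  have hmap : ∀ {V : ∀ n, Ω n → E}, (∀ n, AEMeasurable (V n) (P n)) → ∀ n,
      (P n).map (V n) = (Measure.infinitePi P).map fun w => V n (w n) := by
    intro V hV n
    conv_lhs => rw [← (hev n).map_eq]
    rw [AEMeasurable.map_map_of_aemeasurable (by rw [(hev n).map_eq]; exact hV n)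
      (hev n).aemeasurable]
    rfl
  have hmeas : ∀ {V : ∀ n, Ω n → E}, (∀ n, AEMeasurable (V n) (P n)) → ∀ n,
      AEMeasurable (fun w : ∀ n, Ω n => V n (w n)) (Measure.infinitePi P) := fun hV n =>
    (hV n).comp_quasiMeasurePreserving (hev n).quasiMeasurePreserving
  have hX' := tendstoInDistribution_of_map_eq (P₁ := fun _ : ℕ => Measure.infinitePi P) hX
    (hmeas hX.forall_aemeasurable) hX.aemeasurable_limit
    (fun n => (hmap hX.forall_aemeasurable n).symm) rfl
  have hY' := tendstoInDistribution_of_tendstoInMeasure_sub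
    (fun n (w : ∀ n, Ω n) => Y n (w n)) Z hX' ?_ (hmeas hY)
  · exact tendstoInDistribution_of_map_eq hY' hY hX.aemeasurable_limit (hmap hY) rfl
  · rw [tendstoInMeasure_iff_norm]
    intro ε hε
    refine (hXY ε hε).congr fun n => ?_
    have hnull : NullMeasurableSet {ω | ¬ ‖Y n ω - X n ω‖ < ε} (P n) := by
      simp only [not_lt]
      exact nullMeasurableSet_le aemeasurable_const
        ((hY n).sub (hX.forall_aemeasurable n)).norm
    rw [← (hev n).measure_preimage hnull]
    congr 1
    ext w
    simp

/-- Convergence in distribution is not affected by changes on events of vanishing probability. -/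
lemma tendstoInDistribution_of_whp_eq [TopologicalSpace E] [OpensMeasurableSpace E]
    {X Y : ∀ n, Ω n → E} {Z : Ω' → E}
    (hX : TendstoInDistribution X atTop Z P P') (hY : ∀ n, AEMeasurable (Y n) (P n))
    (hXY : WHP P fun n ω => Y n ω = X n ω) :
    TendstoInDistribution Y atTop Z P P' := by
  refine ⟨hY, hX.aemeasurable_limit, ?_⟩
  -- The target has no norm (it will be `EReal`), so test functions are used: the integral of a
  -- bounded `f` changes by at most `2 * ‖f‖` times the probability that `Y ≠ X`.
  refine ProbabilityMeasure.tendsto_iff_forall_integral_tendsto.2 fun f => ?_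
  have hf := ProbabilityMeasure.tendsto_iff_forall_integral_tendsto.1 hX.tendsto f
  refine tendsto_of_tendsto_of_dist hf ?_
  have hbound : Tendsto (fun n => (ENNReal.ofReal (2 * ‖f‖) * P n {ω | ¬ Y n ω = X n ω}).toReal)
      atTop (𝓝 0) := by
    have := ENNReal.Tendsto.const_mul (a := ENNReal.ofReal (2 * ‖f‖)) hXY
      (Or.inr ENNReal.ofReal_ne_top)
    rw [mul_zero] at this
    exact (ENNReal.tendsto_toReal ENNReal.zero_ne_top).comp this
  refine squeeze_zero (fun _ => dist_nonneg) (fun n => ?_) hbound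
  have hfm : AEStronglyMeasurable f ((P n).map (X n)) :=
    f.continuous.measurable.aestronglyMeasurable
  have hfm' : AEStronglyMeasurable f ((P n).map (Y n)) :=
    f.continuous.measurable.aestronglyMeasurable
  have hint : ∀ {V : Ω n → E}, AEMeasurable V (P n) → Integrable (fun ω => f (V ω)) (P n) :=
    fun hV => Integrable.of_bound
      (f.continuous.measurable.comp_aemeasurable hV).aestronglyMeasurable ‖f‖
      (ae_of_all _ fun ω => f.norm_coe_le_norm _)
  have hXn := hX.forall_aemeasurable n
  simp only [ProbabilityMeasure.coe_mk]
  rw [integral_map hXn hfm, integral_map (hY n) hfm', dist_eq_norm,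
    ← integral_sub (hint hXn) (hint (hY n))]
  refine (norm_integral_le_lintegral_norm _).trans (ENNReal.toReal_mono ?_ ?_)
  · exact ENNReal.mul_ne_top ENNReal.ofReal_ne_top (measure_ne_top _ _)
  · refine le_trans (lintegral_mono fun ω => ?_) (lintegral_indicator_const_le _ _)
    by_cases h : Y n ω = X n ω
    · simp [h]
    · rw [Set.indicator_of_mem (by exact h)]
      apply ENNReal.ofReal_le_ofReal
      refine (norm_sub_le _ _).trans ?_
      linarith [f.norm_coe_le_norm (X n ω), f.norm_coe_le_norm (Y n ω)]

/-- A sequence which converges in distribution is bounded in probability. -/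
lemma exists_forall_measure_norm_le {E : Type*} [MeasurableSpace E] [NormedAddCommGroup E]
    [InnerProductSpace ℝ E] [FiniteDimensional ℝ E] [BorelSpace E] {T : ∀ n, Ω n → E} {Z : Ω' → E}
    (hT : TendstoInDistribution T atTop Z P P') {ε : ℝ≥0∞} (hε : 0 < ε) :
    ∃ K : ℝ, 0 < K ∧ ∀ n, P n {ω | ¬ ‖T n ω‖ ≤ K} ≤ ε := by
  have : ∀ n, IsProbabilityMeasure ((P n).map (T n)) := fun n =>
    Measure.isProbabilityMeasure_map (hT.forall_aemeasurable n)
  have : IsProbabilityMeasure (P'.map Z) := Measure.isProbabilityMeasure_map hT.aemeasurable_limit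
  have h := ProbabilityMeasure.tendsto_iff_tendsto_charFun.1 hT.tendsto
  simp only [ProbabilityMeasure.coe_mk] at h
  -- Convergence of characteristic functions to a limit continuous at zero yields tightness of the
  -- whole sequence, hence one `K` for every `n`.
  have ht := isTightMeasureSet_of_tendsto_charFun
    (continuous_charFun (μ := P'.map Z)).continuousAt h
  rw [isTightMeasureSet_iff_exists_isCompact_measure_compl_le] at ht
  obtain ⟨K, hK, hKε⟩ := ht ε hε
  obtain ⟨R, hR⟩ := hK.isBounded.exists_norm_le
  refine ⟨max R 1, by positivity, fun n => le_trans ?_ (hKε _ ⟨n, rfl⟩)⟩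
  rw [Measure.map_apply_of_aemeasurable (hT.forall_aemeasurable n) hK.measurableSet.compl]
  refine measure_mono fun ω hω hmem => hω ?_
  exact (hR _ hmem).trans (le_max_left _ _)

end Distribution

/-! ### Lyapunov estimates for a single i.i.d. row. -/

noncomputable section

/-- The Lyapunov ratio `E|f|^(2+δ) / N^(δ/2)` of a variable in a row of length `N`. -/
def lyapunov {Ω : Type*} [MeasurableSpace Ω] (P : Measure Ω) (δ : ℝ) (N : ℕ) (f : Ω → ℝ) : ℝ :=
  (∫ ω, |f ω| ^ (2 + δ) ∂P) / (N : ℝ) ^ (δ / 2)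

lemma rpow_mul_sqrt_natCast {κ r : ℝ} {N : ℕ} (hκ : 0 < κ) :
    (κ * √(N : ℝ)) ^ r = κ ^ r * (N : ℝ) ^ (r / 2) := by
  rw [Real.mul_rpow hκ.le (Real.sqrt_nonneg _), Real.sqrt_eq_rpow,
    ← Real.rpow_mul (Nat.cast_nonneg N)]
  ring_nf

section Row

variable {Ω : Type*} [MeasurableSpace Ω] {P : Measure Ω} {δ : ℝ}

lemma integrable_abs_rpow {f : Ω → ℝ} (hδ : 0 < δ) (hf : MemLp f (ENNReal.ofReal (2 + δ)) P) :
    Integrable (fun ω => |f ω| ^ (2 + δ)) P := by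
  have := hf.integrable_norm_rpow (by simpa using by linarith) ENNReal.ofReal_ne_top
  simpa [ENNReal.toReal_ofReal (by linarith : (0 : ℝ) ≤ 2 + δ)] using this

lemma lyapunov_nonneg {N : ℕ} {f : Ω → ℝ} : 0 ≤ lyapunov P δ N f :=
  div_nonneg (integral_nonneg fun _ => by positivity) (by positivity)

variable [IsProbabilityMeasure P]

lemma memLp_two_of_memLp {f : Ω → ℝ} (hδ : 0 < δ) (hf : MemLp f (ENNReal.ofReal (2 + δ)) P) :
    MemLp f 2 P := by
  refine hf.mono_exponent ?_
  rw [show (2 : ℝ≥0∞) = ENNReal.ofReal 2 by simp]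
  exact ENNReal.ofReal_le_ofReal (by linarith)

/-- The maximum of a row is small compared with the square root of its length. -/
lemma measure_exists_le_abs_le {N : ℕ} {h : ℕ → Ω → ℝ} (hN : 0 < N)
    (hident : ∀ i < N, IdentDistrib (h i) (h 0) P P) (hδ : 0 < δ)
    (hp : MemLp (h 0) (ENNReal.ofReal (2 + δ)) P) {κ : ℝ} (hκ : 0 < κ) :
    P {ω | ¬ ∀ i < N, |h i ω| < κ * √N} ≤ ENNReal.ofReal (lyapunov P δ N (h 0) / κ ^ (2 + δ)) := by
  have hNr : (0 : ℝ) < N := by positivity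
  have hx : 0 < κ * √(N : ℝ) := by positivity
  -- Markov's inequality at power `2 + δ`; the union bound costs a factor `N`, and `N / N ^ ((2 + δ)
  -- / 2)` is the normalization in `lyapunov`.
  have hone : ∀ i < N, P {ω | κ * √N ≤ |h i ω|} ≤
      ENNReal.ofReal ((∫ ω, |h 0 ω| ^ (2 + δ) ∂P) / (κ * √N) ^ (2 + δ)) := by
    intro i hi
    have e1 : P {ω | κ * √N ≤ |h i ω|} = P {ω | κ * √N ≤ |h 0 ω|} :=
      (hident i hi).measure_mem_eq (s := {x : ℝ | κ * √N ≤ |x|})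
        (measurableSet_le measurable_const (by fun_prop))
    have e2 : {ω | κ * √N ≤ |h 0 ω|} ⊆ {ω | (κ * √N) ^ (2 + δ) ≤ |h 0 ω| ^ (2 + δ)} :=
      fun ω hω => Real.rpow_le_rpow hx.le hω (by linarith)
    have e3 := mul_meas_ge_le_integral_of_nonneg (μ := P)
      (ae_of_all _ fun ω => (by positivity : 0 ≤ |h 0 ω| ^ (2 + δ)))
      (integrable_abs_rpow hδ hp) ((κ * √N) ^ (2 + δ))
    rw [e1]
    refine (measure_mono e2).trans ?_
    rw [← ofReal_measureReal]
    refine ENNReal.ofReal_le_ofReal ?_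
    rw [le_div_iff₀ (by positivity), mul_comm]
    exact e3
  have hsub : {ω | ¬ ∀ i < N, |h i ω| < κ * √N} ⊆
      ⋃ i ∈ Finset.range N, {ω | κ * √N ≤ |h i ω|} := by
    intro ω hω
    simp only [Set.mem_ofPred_eq, not_forall, not_lt] at hω
    obtain ⟨i, hi, hle⟩ := hω
    simp only [Set.mem_iUnion, Finset.mem_range]
    exact ⟨i, hi, hle⟩
  refine (measure_mono hsub).trans ((measure_biUnion_finset_le _ _).trans ?_)
  refine (Finset.sum_le_sum fun i hi => hone i (Finset.mem_range.1 hi)).trans ?_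
  rw [Finset.sum_const, Finset.card_range, nsmul_eq_mul, ← ENNReal.ofReal_natCast,
    ← ENNReal.ofReal_mul hNr.le]
  refine ENNReal.ofReal_le_ofReal (le_of_eq ?_)
  rw [rpow_mul_sqrt_natCast hκ, lyapunov, show (2 + δ) / 2 = 1 + δ / 2 by ring,
    Real.rpow_add hNr, Real.rpow_one]
  field_simp

/-- The truncated second moment is small (Lindeberg's condition). -/
lemma sq_mul_indicator_le {κ x : ℝ} {N : ℕ} (hκ : 0 < κ) (hN : 0 < N) (hδ : 0 < δ)
    (hx : κ * √N ≤ |x|) : x ^ 2 ≤ |x| ^ (2 + δ) / (N : ℝ) ^ (δ / 2) / κ ^ δ := by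
  have hNr : (0 : ℝ) < N := by positivity
  have hx0 : 0 < κ * √(N : ℝ) := by positivity
  rw [div_div, mul_comm _ (κ ^ δ), ← rpow_mul_sqrt_natCast hκ, le_div_iff₀ (by positivity),
    Real.rpow_add (hx0.trans_le hx), Real.rpow_two, sq_abs]
  exact mul_le_mul_of_nonneg_left (Real.rpow_le_rpow hx0.le hx hδ.le) (sq_nonneg x)

/-- A weak law of large numbers for the squares in a row. -/
lemma measure_abs_sum_sq_sub_le {N : ℕ} {h : ℕ → Ω → ℝ} (hN : 0 < N)
    (hident : ∀ i < N, IdentDistrib (h i) (h 0) P P)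
    (hindep : iIndepFun (fun i : Fin N => h i) P) (hδ : 0 < δ)
    (hp : MemLp (h 0) (ENNReal.ofReal (2 + δ)) P) {κ ε s : ℝ} (hκ : 0 < κ) (hε : 0 < ε)
    (hs : ∫ ω, h 0 ω ^ 2 ∂P = s) (hρ : lyapunov P δ N (h 0) / κ ^ δ ≤ ε / 4) :
    P {ω | ¬ |(N : ℝ)⁻¹ * ∑ i ∈ Finset.range N, h i ω ^ 2 - s| < ε} ≤
      ENNReal.ofReal (lyapunov P δ N (h 0) / κ ^ (2 + δ) + 4 * κ ^ 2 * s / ε ^ 2) := by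
  have hNr : (0 : ℝ) < N := by positivity
  have hsq : (√(N : ℝ)) ^ 2 = N := Real.sq_sqrt hNr.le
  have hL2 := memLp_two_of_memLp hδ hp
  have hs0 : 0 ≤ s := hs ▸ integral_nonneg fun _ => by positivity
  -- Fourth moments may be infinite, so squares are truncated: `g ≤ κ ^ 2 * N` gives `E g ^ 2 ≤ κ ^
  -- 2 * N * s`, while Lindeberg's bound controls the bias.
  let g : ℝ → ℝ := fun x => if |x| < κ * √N then x ^ 2 else 0
  have hg : Measurable g := Measurable.ite (measurableSet_lt (by fun_prop) measurable_const)
    (by fun_prop) measurable_const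
  have hg0 : ∀ x, 0 ≤ g x := fun x => by dsimp only [g]; split_ifs <;> positivity
  have hgle : ∀ x, g x ≤ x ^ 2 := fun x => by
    dsimp only [g]; split_ifs
    · exact le_rfl
    · positivity
  have hgb : ∀ x, g x ≤ κ ^ 2 * N := fun x => by
    dsimp only [g]; split_ifs with hx
    · rw [← hsq, ← mul_pow, ← sq_abs x]
      exact pow_le_pow_left₀ (abs_nonneg x) hx.le 2
    · positivity
  have hm : ∀ i < N, AEMeasurable (h i) P := fun i hi => (hident i hi).aemeasurable_fst
  let u : Fin N → Ω → ℝ := fun i ω => g (h i ω)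
  have hum : ∀ i, AEMeasurable (u i) P := fun i => hg.comp_aemeasurable (hm i i.2)
  have hu2 : ∀ i, MemLp (u i) 2 P := fun i =>
    MemLp.of_bound (hum i).aestronglyMeasurable (κ ^ 2 * N) (ae_of_all _ fun ω => by
      rw [Real.norm_of_nonneg (hg0 _)]; exact hgb _)
  have huid : ∀ i : Fin N, IdentDistrib (u i) (fun ω => g (h 0 ω)) P P := fun i =>
    (hident i i.2).comp hg
  have hmean : ∀ i, ∫ ω, u i ω ∂P = ∫ ω, g (h 0 ω) ∂P := fun i => (huid i).integral_eq
  have hgint : Integrable (fun ω => g (h 0 ω)) P := by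
    have := (hu2 ⟨0, hN⟩).integrable (by norm_num)
    exact this
  have hvar : Var[∑ i, u i; P] ≤ N * (κ ^ 2 * N * s) := by
    rw [IndepFun.variance_sum (fun i _ => hu2 i) (fun i _ j _ hij =>
      (hindep.indepFun hij).comp hg hg)]
    have : ∀ i ∈ Finset.univ, Var[u i; P] ≤ κ ^ 2 * N * s := by
      intro i _
      rw [(huid i).variance_eq]
      refine (variance_le_expectation_sq ((huid i).aemeasurable_snd.aestronglyMeasurable)).trans ?_
      rw [← hs, ← integral_const_mul]
      refine integral_mono_of_nonneg (ae_of_all _ fun ω => sq_nonneg _)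
        (hL2.integrable_sq.const_mul _) (ae_of_all _ fun ω => ?_)
      simp only [Pi.pow_apply]
      rw [sq]
      exact mul_le_mul (hgb _) (hgle _) (hg0 _) (by positivity)
    exact (Finset.sum_le_sum this).trans (by simp)
  have hbias : |∫ ω, g (h 0 ω) ∂P - s| ≤ ε / 4 := by
    refine le_trans ?_ hρ
    rw [abs_sub_comm, ← hs, ← integral_sub hL2.integrable_sq hgint]
    rw [abs_of_nonneg (integral_nonneg fun ω => sub_nonneg.2 (hgle _)), lyapunov,
      ← integral_div, ← integral_div]
    refine integral_mono_of_nonneg (ae_of_all _ fun ω => sub_nonneg.2 (hgle _))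
      (((integrable_abs_rpow hδ hp).div_const _).div_const _) (ae_of_all _ fun ω => ?_)
    dsimp only [g]
    split_ifs with hx
    · rw [sub_self]; positivity
    · rw [sub_zero]
      exact sq_mul_indicator_le hκ hN hδ (not_lt.1 hx)
  -- Error budget for the average: bias at most `ε / 4`, fluctuation below `ε / 2`. Off the event
  -- that some entry reaches the truncation level, both sums agree.
  have hcheb := meas_ge_le_variance_div_sq (μ := P)
    (memLp_finsetSum' Finset.univ fun i _ => hu2 i) (c := N * ε / 2) (by positivity)
  have hsum : ∫ ω, (∑ i, u i) ω ∂P = N * ∫ ω, g (h 0 ω) ∂P := by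
    simp only [Finset.sum_apply]
    rw [integral_finsetSum _ fun i _ => (hu2 i).integrable (by norm_num)]
    simp [hmean]
  have hsub : {ω | ¬ |(N : ℝ)⁻¹ * ∑ i ∈ Finset.range N, h i ω ^ 2 - s| < ε} ⊆
      {ω | ¬ ∀ i < N, |h i ω| < κ * √N} ∪
      {ω | N * ε / 2 ≤ |(∑ i, u i) ω - ∫ ω, (∑ i, u i) ω ∂P|} := by
    intro ω hω
    by_contra hcon
    simp only [Set.mem_union, Set.mem_ofPred_eq, not_or, not_not, not_le] at hcon
    obtain ⟨h1, h2⟩ := hcon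
    apply hω
    have h3 : (∑ i, u i) ω = ∑ i ∈ Finset.range N, h i ω ^ 2 := by
      rw [Finset.sum_apply, Finset.sum_range]
      refine Finset.sum_congr rfl fun i _ => ?_
      dsimp only [u, g]
      rw [if_pos (h1 i i.2)]
    rw [hsum, h3] at h2
    have h4 : |(N : ℝ)⁻¹ * ∑ i ∈ Finset.range N, h i ω ^ 2 - ∫ ω, g (h 0 ω) ∂P| < ε / 2 := by
      have : (N : ℝ)⁻¹ * ∑ i ∈ Finset.range N, h i ω ^ 2 - ∫ ω, g (h 0 ω) ∂P
          = (∑ i ∈ Finset.range N, h i ω ^ 2 - N * ∫ ω, g (h 0 ω) ∂P) / N := by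
        field_simp
      rw [this, abs_div, abs_of_pos hNr, div_lt_iff₀ hNr]
      linarith
    rw [abs_lt] at h4 ⊢
    rw [abs_le] at hbias
    constructor <;> linarith [h4.1, h4.2, hbias.1, hbias.2]
  refine (measure_mono hsub).trans ((measure_union_le _ _).trans ?_)
  have hρ0 : 0 ≤ lyapunov P δ N (h 0) := lyapunov_nonneg
  rw [ENNReal.ofReal_add (by positivity) (by positivity)]
  refine add_le_add (measure_exists_le_abs_le hN hident hδ hp hκ) (hcheb.trans ?_)
  refine ENNReal.ofReal_le_ofReal ?_
  rw [div_le_iff₀ (by positivity)]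
  refine hvar.trans (le_of_eq ?_)
  field_simp
  ring

/-- A second order expansion of the exponential on the imaginary axis. -/
lemma norm_exp_mul_I_sub_le {κ x : ℝ} (hκ : 0 < κ) (hκ1 : κ ≤ 1) (hδ : 0 < δ) :
    ‖Complex.exp (x * Complex.I) - (1 + x * Complex.I - x ^ 2 / 2)‖ ≤
      κ * x ^ 2 + 4 * (|x| ^ (2 + δ) / κ ^ δ) := by
  have hnorm : ‖(x : ℂ) * Complex.I‖ = |x| := by simp
  have hbig : κ ≤ |x| → x ^ 2 ≤ |x| ^ (2 + δ) / κ ^ δ := fun hx => by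
    rw [le_div_iff₀ (by positivity), Real.rpow_add (hκ.trans_le hx), Real.rpow_two, sq_abs]
    exact mul_le_mul_of_nonneg_left (Real.rpow_le_rpow hκ.le hx hδ.le) (sq_nonneg x)
  have hsmall : |x| ≤ 1 →
      ‖Complex.exp (x * Complex.I) - (1 + x * Complex.I - x ^ 2 / 2)‖ ≤ |x| ^ 3 := fun hx => by
    have h := Complex.exp_bound (x := (x : ℂ) * Complex.I) (by rw [hnorm]; exact hx)
      (n := 3) (by norm_num)
    rw [hnorm] at h
    have e : ∑ m ∈ Finset.range 3, ((x : ℂ) * Complex.I) ^ m / (m.factorial : ℂ)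
        = 1 + x * Complex.I - x ^ 2 / 2 := by
      simp only [Finset.sum_range_succ, Finset.sum_range_zero, mul_pow, Complex.I_sq]
      norm_num
      ring
    rw [e] at h
    refine h.trans ?_
    have : 0 ≤ |x| ^ 3 := by positivity
    norm_num [Nat.factorial]
    linarith
  have h0 : 0 ≤ |x| ^ (2 + δ) / κ ^ δ := by positivity
  have h1 : 0 ≤ κ * x ^ 2 := by positivity
  -- Three ranges: up to `κ` the cubic remainder is at most `κ * x ^ 2`; between `κ` and `1` it is
  -- at most `x ^ 2`; beyond `1` the triangle inequality gives `2 + |x| + x ^ 2 / 2 ≤ 4 * x ^ 2`. In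
  -- the last two ranges `x ^ 2` is dominated by the Lyapunov term.
  rcases le_total |x| κ with hx | hx
  · refine (hsmall (hx.trans hκ1)).trans ?_
    have : |x| ^ 3 ≤ κ * x ^ 2 := by
      rw [← sq_abs x, pow_succ, mul_comm]
      exact mul_le_mul_of_nonneg_right hx (by positivity)
    linarith
  · have h2 := hbig hx
    rcases le_total |x| 1 with hx1 | hx1
    · refine (hsmall hx1).trans ?_
      have : |x| ^ 3 ≤ 1 * x ^ 2 := by
        rw [← sq_abs x, pow_succ, mul_comm]
        exact mul_le_mul_of_nonneg_right hx1 (by positivity)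
      linarith [sq_nonneg x]
    · have e1 : ‖Complex.exp (x * Complex.I)‖ = 1 := Complex.norm_exp_ofReal_mul_I x
      have e2 : ‖(1 : ℂ) + x * Complex.I - x ^ 2 / 2‖ ≤ 1 + |x| + x ^ 2 / 2 := by
        refine (norm_sub_le _ _).trans (add_le_add ((norm_add_le _ _).trans ?_) ?_)
        · rw [hnorm]; simp
        · simp
      have e3 : |x| ≤ x ^ 2 := by
        rw [← sq_abs x]; nlinarith
      have := norm_sub_le (Complex.exp (x * Complex.I)) (1 + x * Complex.I - x ^ 2 / 2)
      linarith

/-- The characteristic function of one entry of a row. -/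
lemma norm_charFun_sub_le {N : ℕ} {f : Ω → ℝ} (hN : 0 < N) (hδ : 0 < δ)
    (hp : MemLp f (ENNReal.ofReal (2 + δ)) P) {κ s : ℝ} (hκ : 0 < κ) (hκ1 : κ ≤ 1)
    (hmean : ∫ ω, f ω ∂P = 0) (hs : ∫ ω, f ω ^ 2 ∂P = s) :
    ‖charFun (P.map f) (√N)⁻¹ - (1 - s / (2 * N) : ℝ)‖ ≤
      (κ * s + 4 * (lyapunov P δ N f / κ ^ δ)) / N := by
  have hNr : (0 : ℝ) < N := by positivity
  have hsq : (√(N : ℝ)) ^ 2 = N := Real.sq_sqrt hNr.le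
  have hL2 := memLp_two_of_memLp hδ hp
  have hfm : AEMeasurable f P := hL2.aestronglyMeasurable.aemeasurable
  have hint : Integrable f P := hL2.integrable (by norm_num)
  let y : Ω → ℝ := fun ω => (√N)⁻¹ * f ω
  have hy : ∀ ω, y ω ^ 2 = f ω ^ 2 / N := fun ω => by
    dsimp only [y]; rw [mul_pow, inv_pow, hsq]; ring
  have hyr : ∀ ω, |y ω| ^ (2 + δ) = |f ω| ^ (2 + δ) / (N : ℝ) ^ (δ / 2) / N := fun ω => by
    dsimp only [y]
    have : ((√(N : ℝ))⁻¹) ^ (2 + δ) = ((N : ℝ) ^ (δ / 2) * N)⁻¹ := by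
      rw [Real.inv_rpow (Real.sqrt_nonneg _), Real.sqrt_eq_rpow, ← Real.rpow_mul hNr.le,
        show 1 / 2 * (2 + δ) = δ / 2 + 1 by ring, Real.rpow_add hNr, Real.rpow_one]
    rw [abs_mul, abs_of_nonneg (by positivity), Real.mul_rpow (by positivity) (abs_nonneg _), this,
      div_div, mul_comm, ← div_eq_mul_inv]
  have hexp : Integrable (fun ω => Complex.exp (y ω * Complex.I)) P := by
    refine Integrable.of_bound (C := 1) ?_ (ae_of_all _ fun ω =>
      (Complex.norm_exp_ofReal_mul_I _).le)
    refine AEMeasurable.aestronglyMeasurable ?_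
    fun_prop
  have hyint : Integrable (fun ω => (y ω : ℂ) * Complex.I) P :=
    ((hint.const_mul _).ofReal).mul_const _
  have hy2int : Integrable (fun ω => (y ω : ℂ) ^ 2 / 2) P := by
    have : Integrable (fun ω => y ω ^ 2) P := by
      simp_rw [hy]; exact hL2.integrable_sq.div_const _
    have := (this.ofReal (𝕜 := ℂ)).div_const 2
    refine this.congr (ae_of_all _ fun ω => ?_)
    simp
  have e1 : charFun (P.map f) (√N)⁻¹ = ∫ ω, Complex.exp (y ω * Complex.I) ∂P := by
    rw [charFun_apply_real, integral_map hfm (by fun_prop)]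
    refine integral_congr_ae (ae_of_all _ fun ω => ?_)
    simp [y]
  have e2 : ((1 - s / (2 * N) : ℝ) : ℂ)
      = ∫ ω, (1 + (y ω : ℂ) * Complex.I - (y ω : ℂ) ^ 2 / 2) ∂P := by
    have i1 : Integrable (fun ω => (1 : ℂ) + (y ω : ℂ) * Complex.I) P :=
      (integrable_const _).add hyint
    rw [integral_sub i1 hy2int, integral_add (integrable_const _) hyint]
    have j1 : ∫ ω, (y ω : ℂ) * Complex.I ∂P = 0 := by
      rw [integral_mul_const, integral_complex_ofReal]
      dsimp only [y]
      rw [integral_const_mul, hmean]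
      simp
    have j2 : ∫ ω, (y ω : ℂ) ^ 2 / 2 ∂P = ((s / (2 * N) : ℝ) : ℂ) := by
      rw [← hs, ← integral_div, ← integral_complex_ofReal]
      refine integral_congr_ae (ae_of_all _ fun ω => ?_)
      have := hy ω
      dsimp only
      rw [← Complex.ofReal_pow, this]
      push_cast
      ring
    rw [j1, j2]
    simp
  have i2 : Integrable (fun ω => 1 + (y ω : ℂ) * Complex.I - (y ω : ℂ) ^ 2 / 2) P :=
    ((integrable_const _).add hyint).sub hy2int
  rw [e1, e2, ← integral_sub hexp i2]
  refine (norm_integral_le_integral_norm _).trans ?_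
  have e3 : (κ * s + 4 * (lyapunov P δ N f / κ ^ δ)) / N
      = ∫ ω, (κ * y ω ^ 2 + 4 * (|y ω| ^ (2 + δ) / κ ^ δ)) ∂P := by
    simp_rw [hy, hyr]
    rw [integral_add ((hL2.integrable_sq.div_const _).const_mul _)
      (((((integrable_abs_rpow hδ hp).div_const _).div_const _).div_const _).const_mul _),
      integral_const_mul, integral_const_mul, integral_div, integral_div, integral_div,
      integral_div, hs, lyapunov]
    ring
  rw [e3]
  refine integral_mono_of_nonneg (ae_of_all _ fun ω => norm_nonneg _) ?_
    (ae_of_all _ fun ω => norm_exp_mul_I_sub_le hκ hκ1 hδ)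
  simp_rw [hy, hyr]
  exact ((hL2.integrable_sq.div_const _).const_mul _).add
    (((((integrable_abs_rpow hδ hp).div_const _).div_const _).div_const _).const_mul _)

/-- Powers of complex numbers of the unit disc are Lipschitz in the base. -/
lemma norm_pow_sub_pow_le_mul {z w : ℂ} (hz : ‖z‖ ≤ 1) (hw : ‖w‖ ≤ 1) (n : ℕ) :
    ‖z ^ n - w ^ n‖ ≤ n * ‖z - w‖ := by
  induction n with
  | zero => simp
  | succ n ih =>
    have : z ^ (n + 1) - w ^ (n + 1) = z ^ n * (z - w) + (z ^ n - w ^ n) * w := by ring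
    rw [this]
    refine (norm_add_le _ _).trans ?_
    rw [norm_mul, norm_mul, norm_pow]
    have h1 : ‖z‖ ^ n * ‖z - w‖ ≤ 1 * ‖z - w‖ :=
      mul_le_mul_of_nonneg_right (pow_le_one₀ (norm_nonneg _) hz) (norm_nonneg _)
    have h2 : ‖z ^ n - w ^ n‖ * ‖w‖ ≤ n * ‖z - w‖ * 1 :=
      mul_le_mul ih hw (norm_nonneg _) (by positivity)
    push_cast
    linarith

/-- The characteristic function of the normalized sum of a row. -/
lemma norm_charFun_sum_sub_le {N : ℕ} {h : ℕ → Ω → ℝ} (hN : 0 < N)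
    (hident : ∀ i < N, IdentDistrib (h i) (h 0) P P)
    (hindep : iIndepFun (fun i : Fin N => h i) P) (hδ : 0 < δ)
    (hp : MemLp (h 0) (ENNReal.ofReal (2 + δ)) P) {κ s : ℝ} (hκ : 0 < κ) (hκ1 : κ ≤ 1)
    (hmean : ∫ ω, h 0 ω ∂P = 0) (hs : ∫ ω, h 0 ω ^ 2 ∂P = s) (hsN : s ≤ N) :
    ‖charFun (P.map fun ω => ∑ i ∈ Finset.range N, h i ω) (√N)⁻¹ -
      ((1 + (-s / 2) / N) ^ N : ℝ)‖ ≤ κ * s + 4 * (lyapunov P δ N (h 0) / κ ^ δ) := by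
  have hNr : (0 : ℝ) < N := by positivity
  have hs0 : 0 ≤ s := hs ▸ integral_nonneg fun _ => by positivity
  have h0m := (hident 0 hN).aemeasurable_fst
  have : IsProbabilityMeasure (P.map (h 0)) := Measure.isProbabilityMeasure_map h0m
  have e1 : charFun (P.map fun ω => ∑ i ∈ Finset.range N, h i ω) (√N)⁻¹
      = charFun (P.map (h 0)) (√N)⁻¹ ^ N := by
    simp_rw [Finset.sum_range]
    rw [hindep.charFun_map_fun_sum_eq_prod fun i : Fin N => (hident i i.2).aemeasurable_fst,
      Finset.prod_apply]
    rw [Finset.prod_congr rfl fun (i : Fin N) _ => by rw [(hident i i.2).map_eq]]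
    simp
  have e2 : (1 + (-s / 2) / N : ℝ) = 1 - s / (2 * N) := by field_simp; ring
  -- Keeps `1 - s / (2 * N)` in the unit disc, where taking `N`-th powers costs only a factor `N`,
  -- cancelled by the `1 / N` in the one-entry estimate.
  have hd : s / (2 * N) ≤ 1 := by rw [div_le_one (by positivity)]; linarith
  have hd0 : 0 ≤ s / (2 * N) := by positivity
  rw [e1, e2, Complex.ofReal_pow]
  refine (norm_pow_sub_pow_le_mul (norm_charFun_le_one _) ?_ N).trans ?_
  · rw [Complex.norm_real, Real.norm_eq_abs, abs_le]
    constructor <;> linarith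
  · refine (mul_le_mul_of_nonneg_left (norm_charFun_sub_le hN hδ hp hκ hκ1 hmean hs)
      hNr.le).trans (le_of_eq ?_)
    field_simp

end Row

end

/-! ### Bivariate triangular arrays: Wilks' theorem, central limit theorem, perturbation. -/

noncomputable section

variable {Ω : ℕ → Type*} [∀ n, MeasurableSpace (Ω n)] {P : ∀ n, Measure (Ω n)}

/-- The normalized sums of a bivariate triangular array. -/
def normSum (N : ℕ → ℕ) (f g : ∀ n, ℕ → Ω n → ℝ) (n : ℕ) (ω : Ω n) : EuclideanSpace ℝ (Fin 2) :=
  WithLp.toLp 2 ![(√(N n : ℝ))⁻¹ * ∑ i ∈ Finset.range (N n), f n i ω,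
    (√(N n : ℝ))⁻¹ * ∑ i ∈ Finset.range (N n), g n i ω]

lemma aemeasurable_normSum {N : ℕ → ℕ} {f g : ∀ n, ℕ → Ω n → ℝ}
    (hf : ∀ n, ∀ i < N n, AEMeasurable (f n i) (P n))
    (hg : ∀ n, ∀ i < N n, AEMeasurable (g n i) (P n)) (n : ℕ) :
    AEMeasurable (normSum N f g n) (P n) := by
  have h : ∀ {f : ∀ n, ℕ → Ω n → ℝ}, (∀ n, ∀ i < N n, AEMeasurable (f n i) (P n)) →
      AEMeasurable (fun ω => (√(N n : ℝ))⁻¹ * ∑ i ∈ Finset.range (N n), f n i ω) (P n) :=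
    fun hf => (Finset.aemeasurable_fun_sum _ fun i hi =>
      hf n i (Finset.mem_range.1 hi)).const_mul _
  refine (WithLp.measurable_toLp 2 (Fin 2 → ℝ)).comp_aemeasurable ?_
  refine aemeasurable_pi_lambda _ fun k => ?_
  fin_cases k
  · exact h hf
  · exact h hg

/-- An event which has high probability on every set `‖T‖ ≤ K`, where `T` is bounded in
probability, has high probability. -/
lemma WHP.of_bounded {T : ∀ n, Ω n → ℝ} {q : ∀ n, Ω n → Prop}
    (hT : ∀ ε : ℝ≥0∞, 0 < ε → ∃ K : ℝ, 0 < K ∧ ∀ n, P n {ω | ¬ T n ω ≤ K} ≤ ε)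
    (hq : ∀ K : ℝ, 0 < K → WHP P fun n ω => T n ω ≤ K → q n ω) : WHP P q := by
  rw [WHP, ENNReal.tendsto_nhds_zero]
  intro ε hε
  have hε2 : 0 < ε / 2 := ENNReal.half_pos hε.ne'
  obtain ⟨K, hK, hTK⟩ := hT (ε / 2) hε2
  have h := ENNReal.tendsto_nhds_zero.1 (hq K hK) (ε / 2) hε2
  filter_upwards [h] with n hn
  calc P n {ω | ¬ q n ω} ≤ P n ({ω | ¬ (T n ω ≤ K → q n ω)} ∪ {ω | ¬ T n ω ≤ K}) := by
        refine measure_mono fun ω hω => ?_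
        by_cases hK : T n ω ≤ K
        · exact Or.inl fun h => hω (h hK)
        · exact Or.inr hK
    _ ≤ ε / 2 + ε / 2 := (measure_union_le _ _).trans (add_le_add hn (hTK n))
    _ = ε := ENNReal.add_halves ε

variable [∀ n, IsProbabilityMeasure (P n)]

/-- A bivariate triangular array whose normalized sums are asymptotically standard normal, whose
matrix of second moments is asymptotically the identity and whose maximum is negligible. -/
structure StandardArray (P : ∀ n, Measure (Ω n)) [∀ n, IsProbabilityMeasure (P n)] (N : ℕ → ℕ)
    (f g : ∀ n, ℕ → Ω n → ℝ) : Prop where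
  aemeasurable_fst : ∀ n, ∀ i < N n, AEMeasurable (f n i) (P n)
  aemeasurable_snd : ∀ n, ∀ i < N n, AEMeasurable (g n i) (P n)
  tendsto_normSum : TendstoInDistribution (normSum N f g) atTop
    (fun z : Fin 2 → ℝ => WithLp.toLp 2 z) P (Measure.pi fun _ => gaussianReal 0 1)
  sq_fst : ∀ ε > 0, WHP P fun n ω =>
    |(N n : ℝ)⁻¹ * ∑ i ∈ Finset.range (N n), f n i ω ^ 2 - 1| < ε
  sq_snd : ∀ ε > 0, WHP P fun n ω =>
    |(N n : ℝ)⁻¹ * ∑ i ∈ Finset.range (N n), g n i ω ^ 2 - 1| < ε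
  mul : ∀ ε > 0, WHP P fun n ω =>
    |(N n : ℝ)⁻¹ * ∑ i ∈ Finset.range (N n), f n i ω * g n i ω| < ε
  max_fst : ∀ ε > 0, WHP P fun n ω => ∀ i < N n, |f n i ω| < ε * √(N n : ℝ)
  max_snd : ∀ ε > 0, WHP P fun n ω => ∀ i < N n, |g n i ω| < ε * √(N n : ℝ)

/-- **Wilks' theorem for triangular arrays**: the empirical likelihood statistic of a standard array
is asymptotically chi-square. -/
theorem StandardArray.tendstoInDistribution_negTwoLog_elRatio {N : ℕ → ℕ}
    (hN : Tendsto N atTop atTop) {f g : ∀ n, ℕ → Ω n → ℝ} (H : StandardArray P N f g) :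
    TendstoInDistribution
      (fun n ω => negTwoLog (elRatio (N n) (fun i => f n i ω) (fun i => g n i ω)))
      atTop (fun t : ℝ => (t : EReal)) P (chiSq 2) := by
  obtain ⟨hf, hg, hT, hff, hgg, hfg, hmf, hmg⟩ := H
  set Q : ∀ n, Ω n → EReal :=
    fun n ω => negTwoLog (elRatio (N n) (fun i => f n i ω) (fun i => g n i ω)) with hQ
  have hQm : ∀ n, AEMeasurable (Q n) (P n) := fun n =>
    aemeasurable_negTwoLog_elRatio (hf n) (hg n)
  have hW : TendstoInDistribution (fun n ω => ‖normSum N f g n ω‖ ^ 2) atTop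
      (fun t : ℝ => t) P (chiSq 2) := by
    have h := hT.continuous_comp (g := fun x : EuclideanSpace ℝ (Fin 2) => ‖x‖ ^ 2) (by fun_prop)
    refine tendstoInDistribution_of_map_eq h h.forall_aemeasurable aemeasurable_id
      (fun _ => rfl) ?_
    rw [Measure.map_id', chiSq]
    congr 1
    ext z
    simp [EuclideanSpace.norm_sq_eq]
  have key : ∀ ε > 0, WHP P fun n ω =>
      Q n ω = ((Q n ω).toReal : EReal) ∧ ‖(Q n ω).toReal - ‖normSum N f g n ω‖ ^ 2‖ < ε := by
    intro ε hε
    -- The expansion has error relative to `‖T‖ ^ 2`; tightness confines attention to `‖T‖ ≤ K`,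
    -- where the error is at most `17 * η * K ^ 2`.
    refine WHP.of_bounded (T := fun n ω => ‖normSum N f g n ω‖)
      (fun ε hε => exists_forall_measure_norm_le hT hε) fun K hK => ?_
    obtain ⟨η, hη0, hη1, hη2⟩ : ∃ η : ℝ, 0 < η ∧ η ≤ 1 / 10 ∧ 17 * η * K ^ 2 < ε := by
      refine ⟨min (1 / 10) (ε / (18 * K ^ 2)), by positivity, min_le_left _ _, ?_⟩
      calc 17 * min (1 / 10) (ε / (18 * K ^ 2)) * K ^ 2 ≤ 17 * (ε / (18 * K ^ 2)) * K ^ 2 := by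
            gcongr; exact min_le_right _ _
        _ = 17 / 18 * ε := by field_simp
        _ < ε := by linarith
    -- With entries below `η / (2 * K) * √N` and each mean at most `K / √N`, the product of maximum
    -- and means is at most `η`.
    have hκ : 0 < η / (2 * K) := by positivity
    refine (((((hff η hη0).and (hgg η hη0)).and (hfg η hη0)).and (hmf _ hκ)).and
      (hmg _ hκ)).mono ?_
    filter_upwards [hN.eventually_gt_atTop 0] with n hn ω hω hTK
    obtain ⟨⟨⟨⟨h1, h2⟩, h3⟩, h4⟩, h5⟩ := hω
    have hNr : (0 : ℝ) < N n := by positivity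
    have hsN : (0 : ℝ) < √(N n : ℝ) := by positivity
    have hsq : √(N n : ℝ) ^ 2 = N n := Real.sq_sqrt hNr.le
    have hnorm : ‖normSum N f g n ω‖ ^ 2 = (N n : ℝ) *
        (((N n : ℝ)⁻¹ * ∑ i ∈ Finset.range (N n), f n i ω) ^ 2 +
          ((N n : ℝ)⁻¹ * ∑ i ∈ Finset.range (N n), g n i ω) ^ 2) := by
      rw [EuclideanSpace.norm_sq_eq, Fin.sum_univ_two]
      simp only [normSum, Matrix.cons_val_zero, Matrix.cons_val_one, Real.norm_eq_abs, sq_abs,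
        mul_pow, inv_pow, hsq]
      field_simp
    have hcoord : ∀ k, |normSum N f g n ω k| ≤ K := fun k =>
      (PiLp.norm_apply_le (normSum N f g n ω) k).trans hTK
    have hc : ∀ S : ℝ, |(√(N n : ℝ))⁻¹ * S| ≤ K → |(N n : ℝ)⁻¹ * S| ≤ K / √(N n : ℝ) := by
      intro S hS
      have : |(N n : ℝ)⁻¹ * S| * √(N n : ℝ) = |(N n : ℝ)⁻¹ * S * √(N n : ℝ)| := by
        rw [abs_mul _ (√(N n : ℝ)), abs_of_pos hsN]
      rw [le_div_iff₀ hsN, this]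
      refine le_trans (le_of_eq ?_) hS
      congr 1
      nth_rw 1 [← hsq]
      field_simp
    obtain ⟨r, hr, hrW⟩ := exists_negTwoLog_elRatio hn (e := fun i => f n i ω)
      (v := fun i => g n i ω) (M := η / (2 * K) * √(N n : ℝ)) hη1 (fun i hi => (h4 i hi).le)
      (fun i hi => (h5 i hi).le)
      (m₁ := (N n : ℝ)⁻¹ * ∑ i ∈ Finset.range (N n), f n i ω)
      (m₂ := (N n : ℝ)⁻¹ * ∑ i ∈ Finset.range (N n), g n i ω)
      (a := (N n : ℝ)⁻¹ * ∑ i ∈ Finset.range (N n), f n i ω ^ 2)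
      (b := (N n : ℝ)⁻¹ * ∑ i ∈ Finset.range (N n), f n i ω * g n i ω)
      (c := (N n : ℝ)⁻¹ * ∑ i ∈ Finset.range (N n), g n i ω ^ 2)
      (mul_inv_cancel_left₀ hNr.ne' _).symm (mul_inv_cancel_left₀ hNr.ne' _).symm
      (mul_inv_cancel_left₀ hNr.ne' _).symm (mul_inv_cancel_left₀ hNr.ne' _).symm
      (mul_inv_cancel_left₀ hNr.ne' _).symm h1.le h3.le h2.le
      (by
        calc η / (2 * K) * √(N n : ℝ) * (|(N n : ℝ)⁻¹ * ∑ i ∈ Finset.range (N n), f n i ω| +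
              |(N n : ℝ)⁻¹ * ∑ i ∈ Finset.range (N n), g n i ω|)
            ≤ η / (2 * K) * √(N n : ℝ) * (K / √(N n : ℝ) + K / √(N n : ℝ)) := by
              gcongr
              · exact hc _ (hcoord 0)
              · exact hc _ (hcoord 1)
          _ = η := by field_simp; norm_num)
    have hQr : Q n ω = r := hr
    rw [← hnorm] at hrW
    rw [hQr, EReal.toReal_coe]
    refine ⟨rfl, ?_⟩
    rw [Real.norm_eq_abs]
    refine hrW.trans_lt (lt_of_le_of_lt ?_ hη2)
    gcongr
  -- Slutsky's lemma needs a normed target, so it is applied to `toReal`. The value `⊤` of an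
  -- infeasible sample has vanishing probability and is restored afterwards.
  have hR : TendstoInDistribution (fun n ω => (Q n ω).toReal) atTop (fun t : ℝ => t) P
      (chiSq 2) :=
    tendstoInDistribution_of_whp_sub hW (fun n => (hQm n).ereal_toReal) fun ε hε =>
      (key ε hε).mono (Eventually.of_forall fun n ω h => h.2)
  exact tendstoInDistribution_of_whp_eq
    (hR.continuous_comp (g := fun t : ℝ => (t : EReal)) continuous_coe_real_ereal) hQm
    ((key 1 one_pos).mono (Eventually.of_forall fun n ω h => h.1))

/-- A triangular array whose rows are eventually i.i.d. with mean `0`, variance `s` and a finite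
moment of order `2 + δ`, and which satisfies Lyapunov's condition. -/
structure LyapunovArray (P : ∀ n, Measure (Ω n)) (N : ℕ → ℕ) (δ s : ℝ)
    (h : ∀ n, ℕ → Ω n → ℝ) : Prop where
  ident : ∀ᶠ n in atTop, ∀ i < N n, IdentDistrib (h n i) (h n 0) (P n) (P n)
  indep : ∀ᶠ n in atTop, iIndepFun (fun i : Fin (N n) => h n i) (P n)
  memLp : ∀ᶠ n in atTop, MemLp (h n 0) (ENNReal.ofReal (2 + δ)) (P n)
  mean : ∀ᶠ n in atTop, ∫ ω, h n 0 ω ∂(P n) = 0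
  sq : ∀ᶠ n in atTop, ∫ ω, h n 0 ω ^ 2 ∂(P n) = s
  lyapunov : Tendsto (fun n => lyapunov (P n) δ (N n) (h n 0)) atTop (𝓝 0)

variable {N : ℕ → ℕ} {δ s : ℝ} {h : ∀ n, ℕ → Ω n → ℝ}

lemma LyapunovArray.whp_abs_lt (H : LyapunovArray P N δ s h) (hN : Tendsto N atTop atTop)
    (hδ : 0 < δ) {ε : ℝ} (hε : 0 < ε) :
    WHP P fun n ω => ∀ i < N n, |h n i ω| < ε * √(N n : ℝ) := by
  refine WHP.of_le (u := fun n => ENNReal.ofReal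
    (BandedEL.lyapunov (P n) δ (N n) (h n 0) / ε ^ (2 + δ))) ?_ ?_
  · have := ENNReal.tendsto_ofReal (H.lyapunov.div_const (ε ^ (2 + δ)))
    simpa using this
  · filter_upwards [H.ident, H.memLp, hN.eventually_gt_atTop 0] with n h1 h2 h3
    exact measure_exists_le_abs_le h3 h1 hδ h2 hε

/-- At a fixed truncation level `κ` the Lyapunov terms tend to zero, and the variance term left over
is `O(κ)` with `κ` arbitrary. -/
lemma LyapunovArray.whp_sq (H : LyapunovArray P N δ s h) (hN : Tendsto N atTop atTop)
    (hδ : 0 < δ) {ε : ℝ} (hε : 0 < ε) :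
    WHP P fun n ω => |(N n : ℝ)⁻¹ * ∑ i ∈ Finset.range (N n), h n i ω ^ 2 - s| < ε := by
  refine WHP.of_forall_le (C := 1 + 4 * |s| / ε ^ 2) fun κ hκ hκ1 => ?_
  have l1 := (H.lyapunov.div_const (κ ^ δ))
  have l2 := (H.lyapunov.div_const (κ ^ (2 + δ)))
  rw [zero_div] at l1 l2
  filter_upwards [H.ident, H.indep, H.memLp, H.sq, hN.eventually_gt_atTop 0,
    l1.eventually_le_const (by positivity : (0 : ℝ) < ε / 4), l2.eventually_le_const hκ]
    with n h1 h2 h3 h4 h5 h6 h7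
  refine (measure_abs_sum_sq_sub_le h5 h1 h2 hδ h3 hκ hε h4 h6).trans ?_
  refine ENNReal.ofReal_le_ofReal ?_
  have e1 : 4 * κ ^ 2 * s / ε ^ 2 ≤ 4 * κ * |s| / ε ^ 2 := by
    have : κ ^ 2 ≤ κ := by nlinarith
    gcongr ?_ / _
    calc 4 * κ ^ 2 * s ≤ 4 * κ ^ 2 * |s| := by gcongr; exact le_abs_self s
      _ ≤ 4 * κ * |s| := by gcongr
  have e2 : (1 + 4 * |s| / ε ^ 2) * κ = κ + 4 * κ * |s| / ε ^ 2 := by ring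
  linarith

/-- The distance to `(1 - s / (2N)) ^ N` is at most `κ * s` plus a term vanishing for fixed `κ`, and
that power tends to `exp (-s / 2)`. -/
lemma LyapunovArray.tendsto_charFun (H : LyapunovArray P N δ s h) (hN : Tendsto N atTop atTop)
    (hδ : 0 < δ) :
    Tendsto (fun n => charFun ((P n).map fun ω => ∑ i ∈ Finset.range (N n), h n i ω)
      (√(N n : ℝ))⁻¹) atTop (𝓝 (Real.exp (-s / 2) : ℝ)) := by
  have h1 : Tendsto (fun n => ((1 + (-s / 2) / (N n : ℝ)) ^ N n : ℝ)) atTop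
      (𝓝 (Real.exp (-s / 2))) := (Real.tendsto_one_add_div_pow_exp (-s / 2)).comp hN
  have h2 := (Complex.continuous_ofReal.tendsto _).comp h1
  refine tendsto_of_tendsto_of_dist h2 ?_
  rw [Metric.tendsto_atTop']
  intro ε hε
  obtain ⟨κ, hκ, hκ1, hκs⟩ : ∃ κ : ℝ, 0 < κ ∧ κ ≤ 1 ∧ κ * s < ε / 2 := by
    refine ⟨min 1 (ε / (2 * (|s| + 1))), by positivity, min_le_left _ _, ?_⟩
    calc min 1 (ε / (2 * (|s| + 1))) * s ≤ ε / (2 * (|s| + 1)) * |s| :=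
          mul_le_mul_of_nonneg (min_le_right _ _) (le_abs_self s) (by positivity) (abs_nonneg s)
      _ < ε / (2 * (|s| + 1)) * (|s| + 1) := by
          refine mul_lt_mul_of_pos_left (by linarith) (by positivity)
      _ = ε / 2 := by field_simp
  have l1 := (H.lyapunov.div_const (κ ^ δ)).const_mul 4
  rw [zero_div, mul_zero] at l1
  have hNs : ∀ᶠ n in atTop, s ≤ N n :=
    (tendsto_natCast_atTop_atTop.comp hN).eventually_ge_atTop s
  have := (H.ident.and (H.indep.and (H.memLp.and (H.mean.and (H.sq.and
    ((hN.eventually_gt_atTop 0).and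
    ((l1.eventually_lt_const (by positivity : (0 : ℝ) < ε / 2)).and hNs)))))))
  obtain ⟨n₀, hn₀⟩ := eventually_atTop.1 this
  refine ⟨n₀, fun n hn => ?_⟩
  obtain ⟨h1, h2, h3, h4, h5, h6, h7, h8⟩ := hn₀ n hn.le
  have := norm_charFun_sum_sub_le h6 h1 h2 hδ h3 hκ hκ1 h4 h5 h8
  rw [Real.dist_0_eq_abs, abs_of_nonneg dist_nonneg, dist_comm, dist_eq_norm]
  exact this.trans_lt (by linarith)

/-- The bivariate Lyapunov central limit theorem. -/
theorem tendstoInDistribution_normSum (hN : Tendsto N atTop atTop) (hδ : 0 < δ)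
    {f g : ∀ n, ℕ → Ω n → ℝ}
    (hf : ∀ n, ∀ i < N n, AEMeasurable (f n i) (P n))
    (hg : ∀ n, ∀ i < N n, AEMeasurable (g n i) (P n))
    (H : ∀ a b : ℝ, LyapunovArray P N δ (a ^ 2 + b ^ 2) fun n i ω => a * f n i ω + b * g n i ω) :
    TendstoInDistribution (normSum N f g) atTop (fun z : Fin 2 → ℝ => WithLp.toLp 2 z) P
      (Measure.pi fun _ => gaussianReal 0 1) := by
  refine ⟨aemeasurable_normSum hf hg, (WithLp.measurable_toLp 2 (Fin 2 → ℝ)).aemeasurable,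
    ProbabilityMeasure.tendsto_iff_tendsto_charFun.2 fun t => ?_⟩
  simp only [ProbabilityMeasure.coe_mk]
  have e1 : charFun ((Measure.pi fun _ : Fin 2 => gaussianReal 0 1).map
      fun z : Fin 2 → ℝ => WithLp.toLp 2 z) t = (Real.exp (-(t 0 ^ 2 + t 1 ^ 2) / 2) : ℝ) := by
    have := charFun_pi (μ := fun _ : Fin 2 => gaussianReal 0 1) t
    rw [this, Fin.prod_univ_two, charFun_gaussianReal, charFun_gaussianReal, ← Complex.exp_add]
    push_cast
    congr 1
    simp
    ring
  rw [e1]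
  -- Cramér–Wold: the characteristic function at `t` is that of the scalar array `t 0 * f + t 1 * g`
  -- at `1 / √N`.
  refine ((H (t 0) (t 1)).tendsto_charFun hN hδ).congr fun n => ?_
  have hm : AEMeasurable (fun ω => ∑ i ∈ Finset.range (N n), (t 0 * f n i ω + t 1 * g n i ω))
      (P n) := Finset.aemeasurable_fun_sum _ fun i hi =>
    ((hf n i (Finset.mem_range.1 hi)).const_mul _).add ((hg n i (Finset.mem_range.1 hi)).const_mul _)
  rw [charFun_apply_real, charFun_apply, integral_map hm (by fun_prop),
    integral_map (aemeasurable_normSum hf hg n) (by fun_prop)]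
  refine integral_congr_ae (ae_of_all _ fun ω => ?_)
  simp only
  congr 2
  rw [← Complex.ofReal_mul]
  congr 1
  rw [PiLp.inner_apply, Fin.sum_univ_two]
  simp only [normSum, Matrix.cons_val_zero, Matrix.cons_val_one, RCLike.inner_apply, conj_trivial]
  rw [Finset.sum_add_distrib, ← Finset.mul_sum, ← Finset.mul_sum]
  ring

/-- The sample covariance of the two components of a bivariate Lyapunov array vanishes. -/
lemma whp_mul_of_lyapunovArray (hN : Tendsto N atTop atTop) (hδ : 0 < δ)
    {f g : ∀ n, ℕ → Ω n → ℝ}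
    (H : ∀ a b : ℝ, LyapunovArray P N δ (a ^ 2 + b ^ 2) fun n i ω => a * f n i ω + b * g n i ω)
    {ε : ℝ} (hε : 0 < ε) :
    WHP P fun n ω => |(N n : ℝ)⁻¹ * ∑ i ∈ Finset.range (N n), f n i ω * g n i ω| < ε := by
  -- Polarization: the lack of correlation is encoded in `f + g` having variance `1 + 1`.
  have h1 := (H 1 1).whp_sq hN hδ (half_pos hε)
  have h2 := (H 1 0).whp_sq hN hδ (half_pos hε)
  have h3 := (H 0 1).whp_sq hN hδ (half_pos hε)
  refine ((h1.and h2).and h3).mono (Eventually.of_forall fun n ω hω => ?_)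
  obtain ⟨⟨e1, e2⟩, e3⟩ := hω
  simp only [one_mul, zero_mul, add_zero, zero_add] at e1 e2 e3
  have : (N n : ℝ)⁻¹ * ∑ i ∈ Finset.range (N n), f n i ω * g n i ω =
      ((N n : ℝ)⁻¹ * ∑ i ∈ Finset.range (N n), (f n i ω + g n i ω) ^ 2
        - (N n : ℝ)⁻¹ * ∑ i ∈ Finset.range (N n), f n i ω ^ 2
        - (N n : ℝ)⁻¹ * ∑ i ∈ Finset.range (N n), g n i ω ^ 2) / 2 := by
    rw [← mul_sub, ← mul_sub, ← Finset.sum_sub_distrib, ← Finset.sum_sub_distrib, mul_div_assoc,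
      Finset.sum_div]
    congr 1
    exact Finset.sum_congr rfl fun i _ => by ring
  rw [this]
  rw [abs_lt] at *
  norm_num at e1 e2 e3
  constructor <;> linarith [e1.1, e1.2, e2.1, e2.2, e3.1, e3.2]

/-- A bivariate Lyapunov array is standard. -/
theorem StandardArray.of_lyapunovArray (hN : Tendsto N atTop atTop) (hδ : 0 < δ)
    {f g : ∀ n, ℕ → Ω n → ℝ}
    (hf : ∀ n, ∀ i < N n, AEMeasurable (f n i) (P n))
    (hg : ∀ n, ∀ i < N n, AEMeasurable (g n i) (P n))
    (H : ∀ a b : ℝ, LyapunovArray P N δ (a ^ 2 + b ^ 2) fun n i ω => a * f n i ω + b * g n i ω) :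
    StandardArray P N f g := by
  have h1 : LyapunovArray P N δ 1 f := by simpa using H 1 0
  have h2 : LyapunovArray P N δ 1 g := by simpa using H 0 1
  exact ⟨hf, hg, tendstoInDistribution_normSum hN hδ hf hg H, fun _ => h1.whp_sq hN hδ,
    fun _ => h2.whp_sq hN hδ, fun _ => whp_mul_of_lyapunovArray hN hδ H,
    fun _ => h1.whp_abs_lt hN hδ, fun _ => h2.whp_abs_lt hN hδ⟩

/-- Stability of averages of products under small quadratic perturbations. -/
lemma abs_average_mul_sub_le {N : ℕ} {a b a' b' : ℕ → ℝ} {κ : ℝ} (hκ : 0 < κ) (hκ1 : κ ≤ 1)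
    (ha : (N : ℝ)⁻¹ * ∑ i ∈ Finset.range N, a i ^ 2 ≤ 2)
    (hb : (N : ℝ)⁻¹ * ∑ i ∈ Finset.range N, b i ^ 2 ≤ 2)
    (ha' : (N : ℝ)⁻¹ * ∑ i ∈ Finset.range N, (a' i - a i) ^ 2 ≤ κ ^ 2)
    (hb' : (N : ℝ)⁻¹ * ∑ i ∈ Finset.range N, (b' i - b i) ^ 2 ≤ κ ^ 2) :
    |(N : ℝ)⁻¹ * ∑ i ∈ Finset.range N, a' i * b' i -
      (N : ℝ)⁻¹ * ∑ i ∈ Finset.range N, a i * b i| ≤ 4 * κ := by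
  -- Expand in the increments of `a` and `b`, and weight each mixed product by `κ` so that the large
  -- factor enters with a small coefficient.
  have hterm : ∀ i, |a' i * b' i - a i * b i| ≤ κ / 2 * a i ^ 2 + κ / 2 * b i ^ 2
      + (1 / (2 * κ) + 1 / 2) * (a' i - a i) ^ 2 + (1 / (2 * κ) + 1 / 2) * (b' i - b i) ^ 2 := by
    intro i
    have amgm : ∀ x y : ℝ, |x * y| ≤ κ / 2 * x ^ 2 + 1 / (2 * κ) * y ^ 2 := by
      intro x y
      rw [abs_mul, ← sq_abs x, ← sq_abs y]
      have : κ / 2 * |x| ^ 2 + 1 / (2 * κ) * |y| ^ 2 - |x| * |y|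
          = (κ * |x| - |y|) ^ 2 / (2 * κ) := by field_simp; ring
      have h0 : 0 ≤ (κ * |x| - |y|) ^ 2 / (2 * κ) := by positivity
      linarith
    have h3 : |(a' i - a i) * (b' i - b i)| ≤
        1 / 2 * (a' i - a i) ^ 2 + 1 / 2 * (b' i - b i) ^ 2 := by
      rw [abs_le]
      constructor <;> nlinarith [sq_nonneg (a' i - a i - (b' i - b i)),
        sq_nonneg (a' i - a i + (b' i - b i))]
    have h1 := amgm (a i) (b' i - b i)
    have h2 := amgm (b i) (a' i - a i)
    have e : a' i * b' i - a i * b i = a i * (b' i - b i) + b i * (a' i - a i)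
        + (a' i - a i) * (b' i - b i) := by ring
    rw [e]
    refine (abs_add_three _ _ _).trans ?_
    linarith
  rw [← mul_sub, ← Finset.sum_sub_distrib, abs_mul, abs_of_nonneg (by positivity)]
  calc (N : ℝ)⁻¹ * |∑ i ∈ Finset.range N, (a' i * b' i - a i * b i)|
      ≤ (N : ℝ)⁻¹ * ∑ i ∈ Finset.range N, (κ / 2 * a i ^ 2 + κ / 2 * b i ^ 2
        + (1 / (2 * κ) + 1 / 2) * (a' i - a i) ^ 2
        + (1 / (2 * κ) + 1 / 2) * (b' i - b i) ^ 2) := by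
        gcongr
        exact (Finset.abs_sum_le_sum_abs _ _).trans (Finset.sum_le_sum fun i _ => hterm i)
    _ = κ / 2 * ((N : ℝ)⁻¹ * ∑ i ∈ Finset.range N, a i ^ 2)
        + κ / 2 * ((N : ℝ)⁻¹ * ∑ i ∈ Finset.range N, b i ^ 2)
        + (1 / (2 * κ) + 1 / 2) * ((N : ℝ)⁻¹ * ∑ i ∈ Finset.range N, (a' i - a i) ^ 2)
        + (1 / (2 * κ) + 1 / 2) * ((N : ℝ)⁻¹ * ∑ i ∈ Finset.range N, (b' i - b i) ^ 2) := by
        simp only [Finset.sum_add_distrib, ← Finset.mul_sum]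
        ring
    _ ≤ κ / 2 * 2 + κ / 2 * 2 + (1 / (2 * κ) + 1 / 2) * κ ^ 2
        + (1 / (2 * κ) + 1 / 2) * κ ^ 2 := by gcongr
    _ = 3 * κ + κ ^ 2 := by field_simp; ring
    _ ≤ 4 * κ := by nlinarith

/-- A standard array remains standard under perturbations which are small in quadratic mean and
whose sums are small. -/
theorem StandardArray.of_replError (hN : Tendsto N atTop atTop) {f g f' g' : ∀ n, ℕ → Ω n → ℝ}
    (H : StandardArray P N f g)
    (hf' : ∀ n, ∀ i < N n, AEMeasurable (f' n i) (P n))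
    (hg' : ∀ n, ∀ i < N n, AEMeasurable (g' n i) (P n))
    (hdf : ∀ ε > 0, WHP P fun n ω =>
      replError (N n) (fun i => f n i ω) (fun i => f' n i ω) < ε * N n)
    (hdg : ∀ ε > 0, WHP P fun n ω =>
      replError (N n) (fun i => g n i ω) (fun i => g' n i ω) < ε * N n) :
    StandardArray P N f' g' := by
  have hsq : ∀ {u u' : ∀ n, ℕ → Ω n → ℝ}, (∀ ε > 0, WHP P fun n ω =>
      replError (N n) (fun i => u n i ω) (fun i => u' n i ω) < ε * N n) → ∀ κ > 0,
      WHP P fun n ω => (N n : ℝ)⁻¹ * ∑ i ∈ Finset.range (N n), (u' n i ω - u n i ω) ^ 2 ≤ κ ^ 2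
        ∧ ((√(N n : ℝ))⁻¹ * ∑ i ∈ Finset.range (N n), (u' n i ω - u n i ω)) ^ 2 < κ ^ 2 := by
    intro u u' hu κ hκ
    refine (hu (κ ^ 2) (by positivity)).mono ?_
    filter_upwards [hN.eventually_gt_atTop 0] with n hn ω hω
    have hNr : (0 : ℝ) < N n := by positivity
    rw [replError] at hω
    have h0 : 0 ≤ ∑ i ∈ Finset.range (N n), (u' n i ω - u n i ω) ^ 2 := by positivity
    have h1 := sq_nonneg (∑ i ∈ Finset.range (N n), (u' n i ω - u n i ω))
    rw [mul_pow, inv_pow, Real.sq_sqrt hNr.le, inv_mul_le_iff₀ hNr, inv_mul_lt_iff₀ hNr]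
    constructor <;> linarith
  have hmax : ∀ {u u' : ∀ n, ℕ → Ω n → ℝ}, (∀ ε > 0, WHP P fun n ω =>
      replError (N n) (fun i => u n i ω) (fun i => u' n i ω) < ε * N n) →
      (∀ ε > 0, WHP P fun n ω => ∀ i < N n, |u n i ω| < ε * √(N n : ℝ)) →
      ∀ ε > 0, WHP P fun n ω => ∀ i < N n, |u' n i ω| < ε * √(N n : ℝ) := by
    intro u u' hd hu ε hε
    refine ((hsq hd (ε / 2) (by positivity)).and (hu (ε / 2) (by positivity))).mono ?_
    filter_upwards [hN.eventually_gt_atTop 0] with n hn ω hω i hi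
    have hNr : (0 : ℝ) < N n := by positivity
    obtain ⟨⟨h1, -⟩, h2⟩ := hω
    -- A single squared increment is at most the sum of all of them, so quadratic closeness controls
    -- the maximum as well.
    have h3 : (u' n i ω - u n i ω) ^ 2 ≤ (ε / 2 * √(N n : ℝ)) ^ 2 := by
      rw [inv_mul_le_iff₀ hNr] at h1
      rw [mul_pow, Real.sq_sqrt hNr.le, mul_comm]
      refine le_trans ?_ h1
      exact Finset.single_le_sum (f := fun i => (u' n i ω - u n i ω) ^ 2)
        (fun _ _ => sq_nonneg _) (Finset.mem_range.2 hi)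
    have h4 := abs_le.1 (abs_le_of_sq_le_sq h3 (by positivity))
    have h5 := abs_lt.1 (h2 i hi)
    rw [abs_lt]
    constructor <;> linarith [h4.1, h4.2, h5.1, h5.2]
  -- Covers all second moments: `c = 1` with equal arrays for the squares, `c = 0` for the mixed
  -- product.
  have hprod : ∀ {u v u' v' : ∀ n, ℕ → Ω n → ℝ} {c : ℝ},
      (∀ ε > 0, WHP P fun n ω =>
        replError (N n) (fun i => u n i ω) (fun i => u' n i ω) < ε * N n) →
      (∀ ε > 0, WHP P fun n ω =>
        replError (N n) (fun i => v n i ω) (fun i => v' n i ω) < ε * N n) →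
      (∀ ε > 0, WHP P fun n ω =>
        |(N n : ℝ)⁻¹ * ∑ i ∈ Finset.range (N n), u n i ω ^ 2 - 1| < ε) →
      (∀ ε > 0, WHP P fun n ω =>
        |(N n : ℝ)⁻¹ * ∑ i ∈ Finset.range (N n), v n i ω ^ 2 - 1| < ε) →
      (∀ ε > 0, WHP P fun n ω =>
        |(N n : ℝ)⁻¹ * ∑ i ∈ Finset.range (N n), u n i ω * v n i ω - c| < ε) →
      ∀ ε > 0, WHP P fun n ω =>
        |(N n : ℝ)⁻¹ * ∑ i ∈ Finset.range (N n), u' n i ω * v' n i ω - c| < ε := by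
    intro u v u' v' c hdu hdv hu hv huv ε hε
    have hκ : 0 < min 1 (ε / 8) := by positivity
    refine (((((hsq hdu _ hκ).and (hsq hdv _ hκ)).and (hu 1 one_pos)).and (hv 1 one_pos)).and
      (huv (ε / 2) (by positivity))).mono (Eventually.of_forall fun n ω hω => ?_)
    obtain ⟨⟨⟨⟨⟨h1, -⟩, ⟨h2, -⟩⟩, h3⟩, h4⟩, h5⟩ := hω
    have h6 := abs_average_mul_sub_le (a := fun i => u n i ω) (b := fun i => v n i ω)
      (a' := fun i => u' n i ω) (b' := fun i => v' n i ω) hκ (min_le_left _ _)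
      (by linarith [(abs_lt.1 h3).2]) (by linarith [(abs_lt.1 h4).2]) h1 h2
    have h7 : 4 * min 1 (ε / 8) ≤ ε / 2 := by linarith [min_le_right 1 (ε / 8)]
    rw [abs_lt] at h5 ⊢
    rw [abs_le] at h6
    constructor <;> linarith [h5.1, h5.2, h6.1, h6.2]
  refine ⟨hf', hg', ?_, ?_, ?_, ?_, hmax hdf H.max_fst, hmax hdg H.max_snd⟩
  · refine tendstoInDistribution_of_whp_sub H.tendsto_normSum (aemeasurable_normSum hf' hg') fun ε hε => ?_
    refine ((hsq hdf (ε / 2) (by positivity)).and (hsq hdg (ε / 2) (by positivity))).mono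
      (Eventually.of_forall fun n ω hω => ?_)
    obtain ⟨⟨-, h1⟩, -, h2⟩ := hω
    refine lt_of_pow_lt_pow_left₀ 2 hε.le ?_
    rw [EuclideanSpace.norm_sq_eq, Fin.sum_univ_two]
    simp only [normSum, PiLp.sub_apply, Matrix.cons_val_zero, Matrix.cons_val_one,
      Real.norm_eq_abs, sq_abs, ← mul_sub, ← Finset.sum_sub_distrib]
    nlinarith
  · simpa only [sq] using hprod hdf hdf H.sq_fst H.sq_fst (by simpa only [sq] using H.sq_fst)
  · simpa only [sq] using hprod hdg hdg H.sq_snd H.sq_snd (by simpa only [sq] using H.sq_snd)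
  · simpa only [sub_zero] using hprod (c := 0) hdf hdg H.sq_fst H.sq_snd
      (by simpa only [sub_zero] using H.mul)

end

/-! ### Independent pairs and moments of the bilinear kernel. -/

noncomputable section

/-- Independent variables remain independent when they are grouped in pairs. -/
lemma iIndepFun_prodMk_of_sum {Ω ι E : Type*} [MeasurableSpace Ω] {P : Measure Ω}
    [IsProbabilityMeasure P] [Fintype ι] [MeasurableSpace E] {X : ι ⊕ ι → Ω → E}
    (hX : ∀ i, AEMeasurable (X i) P) (h : iIndepFun X P) :
    iIndepFun (fun i ω => (X (Sum.inl i) ω, X (Sum.inr i) ω)) P := by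
  have hprob : ∀ i, IsProbabilityMeasure (P.map (X i)) := fun i =>
    Measure.isProbabilityMeasure_map (hX i)
  rw [iIndepFun_iff_map_fun_eq_pi_map fun i => (hX _).prodMk (hX _)]
  have hpair : ∀ i, P.map (fun ω => (X (Sum.inl i) ω, X (Sum.inr i) ω)) =
      (P.map (X (Sum.inl i))).prod (P.map (X (Sum.inr i))) := fun i =>
    (h.indepFun (by simp)).map_prod_eq_prod_map_map (hX _) (hX _)
  simp_rw [hpair]
  have h1 := measurePreserving_sumPiEquivProdPi fun i => P.map (X i)
  have h2 := (measurePreserving_arrowProdEquivProdArrow E E ι (fun i => P.map (X (Sum.inl i)))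
    fun i => P.map (X (Sum.inr i))).symm
  rw [← (h2.comp h1).map_eq, ← h.map_fun_eq_pi_map hX,
    AEMeasurable.map_map_of_aemeasurable (h2.comp h1).measurable.aemeasurable
      (aemeasurable_pi_lambda _ hX)]
  rfl

section Kernel

variable {E κ : Type*} [MeasurableSpace E] [Fintype κ] {ν : Measure E} [IsProbabilityMeasure ν]
  {A : κ → E → ℝ}

/-- If a random vector is orthogonal to an independent copy of itself, it vanishes. -/
lemma ae_eq_zero_of_ae_orthogonal
    (h : ∀ᵐ z ∂(ν.prod ν), ∑ k, A k z.1 * A k z.2 = 0) : ∀ᵐ x ∂ν, ∀ k, A k x = 0 := by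
  -- `V` consists of the vectors almost surely orthogonal to `A(y)`. Being finitely generated, it
  -- needs only one null set for all its members; `A(y)` itself lies in `V` almost surely, hence is
  -- orthogonal to itself.
  let V : Submodule ℝ (κ → ℝ) :=
    { carrier := {u | ∀ᵐ y ∂ν, ∑ k, u k * A k y = 0}
      add_mem' := by
        intro u w hu hw
        refine Set.mem_ofPred_eq.to_iff.2 ?_
        filter_upwards [Set.mem_ofPred_eq.to_iff.1 hu, Set.mem_ofPred_eq.to_iff.1 hw] with y h1 h2
        simp only [Pi.add_apply, add_mul, Finset.sum_add_distrib, h1, h2, add_zero]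
      zero_mem' := by simp
      smul_mem' := by
        intro c u hu
        refine Set.mem_ofPred_eq.to_iff.2 ?_
        filter_upwards [Set.mem_ofPred_eq.to_iff.1 hu] with y h1
        simp only [Pi.smul_apply, smul_eq_mul, mul_assoc, ← Finset.mul_sum, h1, mul_zero] }
  have h1 : ∀ᵐ x ∂ν, (fun k => A k x) ∈ V := Measure.ae_ae_of_ae_prod h
  obtain ⟨s, hs⟩ := (inferInstance : Module.Finite ℝ V) |> Module.Finite.iff_fg.1
  have h2 : ∀ᵐ y ∂ν, ∀ u ∈ s, ∑ k, u k * A k y = 0 :=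
    (Finset.eventually_all s).2 fun u hu => by
      have : u ∈ V := hs ▸ Submodule.subset_span hu
      exact this
  filter_upwards [h1, h2] with y hy1 hy2
  have h3 : ∀ u ∈ V, ∑ k, u k * A k y = 0 := by
    intro u hu
    rw [← hs] at hu
    induction hu using Submodule.span_induction with
    | mem u hu => exact hy2 u hu
    | zero => simp
    | add u w _ _ h1 h2 => simp only [Pi.add_apply, add_mul, Finset.sum_add_distrib, h1, h2, add_zero]
    | smul c u _ h1 =>
      simp only [Pi.smul_apply, smul_eq_mul, mul_assoc, ← Finset.mul_sum, h1, mul_zero]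
  have h4 := h3 _ hy1
  intro k
  have h5 := (Finset.sum_eq_zero_iff_of_nonneg fun k _ => mul_self_nonneg (A k y)).1 h4 k
    (Finset.mem_univ k)
  exact mul_self_eq_zero.1 h5

lemma integral_kernel (hA : ∀ k, Integrable (A k) ν) (h0 : ∀ k, ∫ x, A k x ∂ν = 0) :
    ∫ z, ∑ k, A k z.1 * A k z.2 ∂(ν.prod ν) = 0 := by
  rw [integral_finsetSum _ fun k _ => (hA k).mul_prod (hA k)]
  exact Finset.sum_eq_zero fun k _ => by rw [integral_prod_mul, h0, zero_mul]

lemma integral_add_fst_snd {α : E → ℝ} (hα : Integrable α ν) (h0 : ∫ x, α x ∂ν = 0) :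
    ∫ z, (α z.1 + α z.2) ∂(ν.prod ν) = 0 := by
  rw [integral_add (hα.comp_fst ν) (hα.comp_snd ν), integral_fun_fst, integral_fun_snd, h0]
  simp

/-- If the sum of two independent copies is square integrable, so is each of them. -/
lemma memLp_two_fst_of_add {α : E → ℝ} (hα : Integrable α ν)
    (h2 : MemLp (fun z : E × E => α z.1 + α z.2) 2 (ν.prod ν)) :
    MemLp (fun z : E × E => α z.1) 2 (ν.prod ν) := by
  have hm := (hα.comp_fst ν).aestronglyMeasurable
  rw [memLp_two_iff_integrable_sq hm]
  -- The cross term is integrable by independence alone; removing it from the square leaves `α z.1 ^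
  -- 2 + α z.2 ^ 2`.
  have h := h2.integrable_sq.sub ((hα.mul_prod hα).const_mul 2)
  refine h.mono (hm.pow 2) (ae_of_all _ fun z => ?_)
  simp only [Pi.sub_apply]
  rw [Real.norm_of_nonneg (sq_nonneg _)]
  refine le_trans ?_ (le_abs_self _)
  nlinarith [sq_nonneg (α z.2)]

/-- The kernel statistic is uncorrelated with the linear one. -/
lemma integral_kernel_mul_add (hA : ∀ k, Integrable (A k) ν) (h0 : ∀ k, ∫ x, A k x ∂ν = 0)
    {α : E → ℝ} (hα : Integrable α ν)
    (hφ : MemLp (fun z : E × E => ∑ k, A k z.1 * A k z.2) 2 (ν.prod ν))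
    (hψ : MemLp (fun z : E × E => α z.1 + α z.2) 2 (ν.prod ν)) :
    ∫ z, (∑ k, A k z.1 * A k z.2) * (α z.1 + α z.2) ∂(ν.prod ν) = 0 := by
  have hα2 := memLp_two_fst_of_add hα hψ
  have i1 : Integrable (fun z : E × E => (∑ k, A k z.1 * A k z.2) * α z.1) (ν.prod ν) :=
    hφ.integrable_mul hα2
  -- With the first variable fixed, the inner integral is linear in the vanishing means of the `A
  -- k`. The other half follows by exchanging the variables.
  have e1 : ∫ z, (∑ k, A k z.1 * A k z.2) * α z.1 ∂(ν.prod ν) = 0 := by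
    rw [integral_prod _ i1]
    refine integral_eq_zero_of_ae (ae_of_all _ fun x => ?_)
    simp only [Pi.zero_apply]
    rw [integral_mul_const, integral_finsetSum _ fun k _ => (hA k).const_mul _]
    simp only [integral_const_mul, h0, mul_zero, Finset.sum_const_zero, zero_mul]
  have hswap : (fun z : E × E => (∑ k, A k z.1 * A k z.2) * α z.2) =
      fun z => (fun w : E × E => (∑ k, A k w.1 * A k w.2) * α w.1) z.swap := by
    ext z
    simp only [Prod.fst_swap, Prod.snd_swap]
    congr 1
    exact Finset.sum_congr rfl fun k _ => mul_comm _ _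
  have i2 : Integrable (fun z : E × E => (∑ k, A k z.1 * A k z.2) * α z.2) (ν.prod ν) := by
    rw [hswap]; exact i1.swap
  have e2 : ∫ z, (∑ k, A k z.1 * A k z.2) * α z.2 ∂(ν.prod ν) = 0 := by
    rw [hswap]
    exact (integral_prod_swap fun w : E × E => (∑ k, A k w.1 * A k w.2) * α w.1).trans e1
  simp_rw [mul_add]
  rw [integral_add i1 i2, e1, e2, add_zero]

/-- The kernel statistic is not degenerate if the linear one is not. -/
lemma integral_kernel_sq_pos
    (hφ : MemLp (fun z : E × E => ∑ k, A k z.1 * A k z.2) 2 (ν.prod ν))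
    (hpos : 0 < ∫ z, (∑ k, A k z.1 + ∑ k, A k z.2) ^ 2 ∂(ν.prod ν)) :
    0 < ∫ z, (∑ k, A k z.1 * A k z.2) ^ 2 ∂(ν.prod ν) := by
  refine lt_of_le_of_ne (integral_nonneg fun _ => sq_nonneg _) fun h => hpos.ne' ?_
  -- A null second moment makes the kernel vanish almost surely, so every `A k` vanishes and so does
  -- the linear statistic.
  have h1 := (integral_eq_zero_iff_of_nonneg (fun _ => sq_nonneg _) hφ.integrable_sq).1 h.symm
  have h2 := ae_eq_zero_of_ae_orthogonal (A := A) (ν := ν)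
    (h1.mono fun z hz => pow_eq_zero_iff two_ne_zero |>.1 hz)
  refine integral_eq_zero_of_ae ?_
  have h3 := Measure.quasiMeasurePreserving_fst (μ := ν) (ν := ν) |>.ae h2
  have h4 := Measure.quasiMeasurePreserving_snd (μ := ν) (ν := ν) |>.ae h2
  filter_upwards [h3, h4] with z hz1 hz2
  simp [hz1, hz2]

end Kernel

/-! ### The statistics in terms of off-band entries. -/

section Statistic

variable {p : ℕ}

/-- An entry of the off-band part of `(x - m)(x - m)ᵀ`. -/
def offBandEntry (τ : ℕ) (m : Fin p → ℝ) (k : Fin p × Fin p) (x : Fin p → ℝ) : ℝ :=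
  offBand τ (outer m x) k.1 k.2

lemma offBandEntry_eq (τ : ℕ) (m : Fin p → ℝ) (k : Fin p × Fin p) (x : Fin p → ℝ) :
    offBandEntry τ m k x = if (τ : ℤ) ≤ |(k.1 : ℤ) - (k.2 : ℤ)|
      then (x k.1 - m k.1) * (x k.2 - m k.2) else 0 := rfl

lemma measurable_offBandEntry {Ω : Type*} [MeasurableSpace Ω] {τ : ℕ} {m x : Ω → Fin p → ℝ}
    (hm : Measurable m) (hx : Measurable x) (k : Fin p × Fin p) :
    Measurable fun ω => offBandEntry τ (m ω) k (x ω) := by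
  simp only [offBandEntry_eq]
  split_ifs <;> fun_prop

lemma offBandEntry_swap (τ : ℕ) (m : Fin p → ℝ) (a b : Fin p) (x : Fin p → ℝ) :
    offBandEntry τ m (b, a) x = offBandEntry τ m (a, b) x := by
  simp only [offBandEntry_eq, abs_sub_comm (b : ℤ) (a : ℤ), mul_comm (x b - m b)]

lemma entrySum_eq (M : Matrix (Fin p) (Fin p) ℝ) : entrySum M = ∑ k : Fin p × Fin p, M k.1 k.2 := by
  rw [entrySum, Fintype.sum_prod_type]
  simp [dotProduct, Matrix.mulVec]

/-- The off-band matrices are symmetric, so the trace of a product is the entrywise inner product,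
bilinear in the two observations. -/
lemma eKnown_eq (N τ : ℕ) (m : Fin p → ℝ) {S : Matrix (Fin p) (Fin p) ℝ} (hS : offBand τ S = 0)
    (x : ℕ → Fin p → ℝ) (i : ℕ) :
    eKnown N τ m S x i = ∑ k, offBandEntry τ m k (x i) * offBandEntry τ m k (x (N + i)) := by
  rw [eKnown, hS, sub_zero, sub_zero, Fintype.sum_prod_type, Matrix.trace]
  refine Finset.sum_congr rfl fun a _ => ?_
  rw [Matrix.diag_apply, Matrix.mul_apply]
  refine Finset.sum_congr rfl fun b _ => ?_
  rw [← offBandEntry_swap τ m a b (x (N + i))]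
  rfl

lemma vKnown_eq (N τ : ℕ) (m : Fin p → ℝ) {S : Matrix (Fin p) (Fin p) ℝ} (hS : offBand τ S = 0)
    (x : ℕ → Fin p → ℝ) (i : ℕ) :
    vKnown N τ m S x i = ∑ k, offBandEntry τ m k (x i) + ∑ k, offBandEntry τ m k (x (N + i)) := by
  rw [vKnown, hS, smul_zero, sub_zero, entrySum_eq, ← Finset.sum_add_distrib]
  rfl

lemma offBand_eq_zero {τ : ℕ} {S : Matrix (Fin p) (Fin p) ℝ}
    (hS : ∀ a b : Fin p, (τ : ℤ) ≤ |(a : ℤ) - (b : ℤ)| → S a b = 0) : offBand τ S = 0 := by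
  ext a b
  rw [offBand, Matrix.of_apply]
  split_ifs with h
  · exact hS a b h
  · rfl

lemma measurable_means {Ω : Type*} [MeasurableSpace Ω] {N : ℕ} {X : ℕ → Ω → Fin p → ℝ}
    (hX : ∀ i < 2 * N, Measurable (X i)) :
    Measurable (fun ω => mean₁ N fun k => X k ω) ∧ Measurable fun ω => mean₂ N fun k => X k ω := by
  have h : ∀ f : ℕ → ℕ, (∀ i < N, f i < 2 * N) →
      Measurable fun ω => (N : ℝ)⁻¹ • ∑ i ∈ Finset.range N, X (f i) ω := fun f hf =>
    (Finset.measurable_fun_sum _ fun i hi =>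
      hX _ (hf i (Finset.mem_range.1 hi))).const_smul (N : ℝ)⁻¹
  exact ⟨h (fun i => i) fun i hi => by omega, h (fun i => N + i) fun i hi => by omega⟩

lemma measurable_eStar {Ω : Type*} [MeasurableSpace Ω] {N τ : ℕ} {S : Matrix (Fin p) (Fin p) ℝ}
    {X : ℕ → Ω → Fin p → ℝ} (hX : ∀ i < 2 * N, Measurable (X i)) {i : ℕ} (hi : i < N) :
    Measurable fun ω => eStar N τ S (fun k => X k ω) i := by
  obtain ⟨h1, h2⟩ := measurable_means hX
  simp only [eStar, Matrix.trace, Matrix.diag_apply, Matrix.mul_apply, Matrix.sub_apply]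
  refine Finset.measurable_fun_sum _ fun a _ => Finset.measurable_fun_sum _ fun b _ => ?_
  exact ((measurable_offBandEntry h1 (hX i (by omega)) (a, b)).sub_const _).mul
    ((measurable_offBandEntry h2 (hX (N + i) (by omega)) (b, a)).sub_const _)

lemma measurable_vStar {Ω : Type*} [MeasurableSpace Ω] {N τ : ℕ} {S : Matrix (Fin p) (Fin p) ℝ}
    {X : ℕ → Ω → Fin p → ℝ} (hX : ∀ i < 2 * N, Measurable (X i)) {i : ℕ} (hi : i < N) :
    Measurable fun ω => vStar N τ S (fun k => X k ω) i := by
  obtain ⟨h1, h2⟩ := measurable_means hX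
  simp only [vStar, entrySum_eq, Matrix.sub_apply, Matrix.add_apply]
  refine Finset.measurable_fun_sum _ fun k _ => ?_
  exact ((measurable_offBandEntry h1 (hX i (by omega)) k).add
    (measurable_offBandEntry h2 (hX (N + i) (by omega)) k)).sub_const _

/-- This and the next three lemmas let `S₀` be exchanged for the true covariance matrix. -/
lemma eStar_congr {N τ : ℕ} {S S' : Matrix (Fin p) (Fin p) ℝ} (h : offBand τ S = offBand τ S')
    (x : ℕ → Fin p → ℝ) (i : ℕ) : eStar N τ S x i = eStar N τ S' x i := by
  rw [eStar, eStar, h]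

lemma vStar_congr {N τ : ℕ} {S S' : Matrix (Fin p) (Fin p) ℝ} (h : offBand τ S = offBand τ S')
    (x : ℕ → Fin p → ℝ) (i : ℕ) : vStar N τ S x i = vStar N τ S' x i := by
  rw [vStar, vStar, h]

lemma eKnown_congr {N τ : ℕ} {m : Fin p → ℝ} {S S' : Matrix (Fin p) (Fin p) ℝ}
    (h : offBand τ S = offBand τ S') (x : ℕ → Fin p → ℝ) (i : ℕ) :
    eKnown N τ m S x i = eKnown N τ m S' x i := by
  rw [eKnown, eKnown, h]

lemma vKnown_congr {N τ : ℕ} {m : Fin p → ℝ} {S S' : Matrix (Fin p) (Fin p) ℝ}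
    (h : offBand τ S = offBand τ S') (x : ℕ → Fin p → ℝ) (i : ℕ) :
    vKnown N τ m S x i = vKnown N τ m S' x i := by
  rw [vKnown, vKnown, h]

end Statistic

end

/-! ### Moments under the null hypothesis and Lyapunov ratios. -/

noncomputable section

section Model

variable {Ω : Type*} [MeasurableSpace Ω] {P : Measure Ω} [IsProbabilityMeasure P] {p τ n N : ℕ}
  {X : ℕ → Ω → Fin p → ℝ}

/-- The pairs `(X i, X (N + i))`, `i < N`, of an i.i.d. sample are independent. -/
lemma iIndepFun_pairs (hX : ∀ i < n, Measurable (X i)) (hindep : iIndepFun (fun i : Fin n => X i) P)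
    (hn : 2 * N ≤ n) : iIndepFun (fun (i : Fin N) ω => (X i ω, X (N + i) ω)) P := by
  let g : Fin N ⊕ Fin N → Fin n :=
    Sum.elim (fun j : Fin N => ⟨j, by omega⟩) fun j : Fin N => ⟨N + j, by omega⟩
  have hg : Function.Injective g := by
    rintro (i | i) (j | j) h <;> simp only [g, Sum.elim_inl, Sum.elim_inr, Fin.mk.injEq] at h
    · exact congrArg _ (Fin.ext h)
    · omega
    · omega
    · exact congrArg _ (Fin.ext (by omega))
  exact iIndepFun_prodMk_of_sum (X := fun i => X (g i)) (fun i => (hX _ (g i).2).aemeasurable)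
    (hindep.precomp hg)

/-- The law of the pair `(X i, X (N + i))`. -/
lemma map_pair (hX : ∀ i < n, Measurable (X i)) (hindep : iIndepFun (fun i : Fin n => X i) P)
    (hident : ∀ i < n, IdentDistrib (X i) (X 0) P P) (hn : 2 * N ≤ n) {i : ℕ} (hi : i < N) :
    P.map (fun ω => (X i ω, X (N + i) ω)) = (P.map (X 0)).prod (P.map (X 0)) := by
  have hi1 : i < n := by omega
  have hi2 : N + i < n := by omega
  have h : IndepFun (X i) (X (N + i)) P :=
    hindep.indepFun (i := ⟨i, hi1⟩) (j := ⟨N + i, hi2⟩) (by simp; omega)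
  rw [h.map_prod_eq_prod_map_map (hX _ hi1).aemeasurable (hX _ hi2).aemeasurable,
    (hident _ hi1).map_eq, (hident _ hi2).map_eq]

/-- The off-band entries have mean zero under the null hypothesis. -/
lemma integrable_integral_offBandEntry {m : Fin p → ℝ} {S : Matrix (Fin p) (Fin p) ℝ}
    {x : Ω → Fin p → ℝ} (hx : Measurable x) (hL2 : ∀ a, MemLp (fun ω => x ω a) 2 P)
    (hmean : ∀ a, ∫ ω, x ω a ∂P = m a)
    (hcov : ∀ a b, cov[fun ω => x ω a, fun ω => x ω b; P] = S a b)
    (hH0 : ∀ a b : Fin p, (τ : ℤ) ≤ |(a : ℤ) - (b : ℤ)| → S a b = 0) (k : Fin p × Fin p) :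
    Integrable (offBandEntry τ m k) (P.map x) ∧ ∫ y, offBandEntry τ m k y ∂(P.map x) = 0 := by
  have hm : Measurable (offBandEntry τ m k) := measurable_offBandEntry measurable_const
    measurable_id k
  rw [integrable_map_measure hm.aestronglyMeasurable hx.aemeasurable,
    integral_map hx.aemeasurable hm.aestronglyMeasurable]
  simp only [offBandEntry_eq, Function.comp_def]
  split_ifs with h
  · refine ⟨((hL2 k.1).sub (memLp_const _)).integrable_mul ((hL2 k.2).sub (memLp_const _)), ?_⟩
    rw [← hH0 k.1 k.2 h, ← hcov, covariance, hmean, hmean]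
  · simp

/-- The first two moments of the statistics under the null hypothesis. -/
lemma moments_eKnown_vKnown {m : Fin p → ℝ} {S : Matrix (Fin p) (Fin p) ℝ}
    (hX : ∀ i < n, Measurable (X i)) (hindep : iIndepFun (fun i : Fin n => X i) P)
    (hident : ∀ i < n, IdentDistrib (X i) (X 0) P P) (hN : 0 < N) (hn : 2 * N ≤ n)
    (hL2 : ∀ a, MemLp (fun ω => X 0 ω a) 2 P) (hmean : ∀ a, ∫ ω, X 0 ω a ∂P = m a)
    (hcov : ∀ a b, cov[fun ω => X 0 ω a, fun ω => X 0 ω b; P] = S a b)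
    (hH0 : ∀ a b : Fin p, (τ : ℤ) ≤ |(a : ℤ) - (b : ℤ)| → S a b = 0) {e v : Ω → ℝ}
    (he : e = fun ω => eKnown N τ m S (fun k => X k ω) 0)
    (hv : v = fun ω => vKnown N τ m S (fun k => X k ω) 0)
    (he2 : MemLp e 2 P) (hv2 : MemLp v 2 P) (hpos : 0 < ∫ ω, v ω ^ 2 ∂P) :
    ∫ ω, e ω ∂P = 0 ∧ ∫ ω, v ω ∂P = 0 ∧ ∫ ω, e ω * v ω ∂P = 0 ∧ 0 < ∫ ω, e ω ^ 2 ∂P := by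
  have hX0 : Measurable (X 0) := hX 0 (by omega)
  have hXN : Measurable (X (N + 0)) := hX _ (by omega)
  have : IsProbabilityMeasure (P.map (X 0)) := Measure.isProbabilityMeasure_map hX0.aemeasurable
  have hoff := offBand_eq_zero hH0
  let A : Fin p × Fin p → (Fin p → ℝ) → ℝ := offBandEntry τ m
  let φ : (Fin p → ℝ) × (Fin p → ℝ) → ℝ := fun z => ∑ k, A k z.1 * A k z.2
  let ψ : (Fin p → ℝ) × (Fin p → ℝ) → ℝ := fun z => ∑ k, A k z.1 + ∑ k, A k z.2
  have hAm : ∀ k, Measurable (A k) := fun k => measurable_offBandEntry measurable_const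
    measurable_id k
  have hφm : Measurable φ := by fun_prop
  have hψm : Measurable ψ := by fun_prop
  let T : Ω → (Fin p → ℝ) × (Fin p → ℝ) := fun ω => (X 0 ω, X (N + 0) ω)
  have hT : AEMeasurable T P := (hX0.prodMk hXN).aemeasurable
  have hlaw : P.map T = (P.map (X 0)).prod (P.map (X 0)) := map_pair hX hindep hident hn hN
  have heφ : e = φ ∘ T := by
    rw [he]; ext ω; exact eKnown_eq N τ m hoff _ 0
  have hvψ : v = ψ ∘ T := by
    rw [hv]; ext ω; exact vKnown_eq N τ m hoff _ 0
  have hA := fun k => integrable_integral_offBandEntry (τ := τ) hX0 hL2 hmean hcov hH0 k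
  have hφ2 : MemLp φ 2 ((P.map (X 0)).prod (P.map (X 0))) := by
    rw [← hlaw, memLp_map_measure_iff hφm.aestronglyMeasurable hT, ← heφ]; exact he2
  have hψ2 : MemLp ψ 2 ((P.map (X 0)).prod (P.map (X 0))) := by
    rw [← hlaw, memLp_map_measure_iff hψm.aestronglyMeasurable hT, ← hvψ]; exact hv2
  have htrans : ∀ F : (Fin p → ℝ) × (Fin p → ℝ) → ℝ, Measurable F →
      ∫ ω, F (T ω) ∂P = ∫ z, F z ∂((P.map (X 0)).prod (P.map (X 0))) := fun F hF => by
    rw [← hlaw, integral_map hT hF.aestronglyMeasurable]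
  have hα : Integrable (fun x => ∑ k, A k x) (P.map (X 0)) :=
    integrable_finsetSum _ fun k _ => (hA k).1
  have hα0 : ∫ x, ∑ k, A k x ∂(P.map (X 0)) = 0 := by
    rw [integral_finsetSum _ fun k _ => (hA k).1]
    exact Finset.sum_eq_zero fun k _ => (hA k).2
  rw [hvψ] at hpos
  rw [heφ, hvψ]
  simp only [Function.comp_apply] at hpos ⊢
  refine ⟨?_, ?_, ?_, ?_⟩
  · rw [htrans φ hφm]
    exact integral_kernel (fun k => (hA k).1) fun k => (hA k).2
  · rw [htrans ψ hψm]
    exact integral_add_fst_snd hα hα0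
  · rw [htrans (fun z => φ z * ψ z) (hφm.mul hψm)]
    exact integral_kernel_mul_add (fun k => (hA k).1) (fun k => (hA k).2) hα hφ2 hψ2
  · rw [htrans (fun z => φ z ^ 2) (hφm.pow_const 2)]
    rw [htrans (fun z => ψ z ^ 2) (hψm.pow_const 2)] at hpos
    exact integral_kernel_sq_pos hφ2 hpos

end Model

/-- A Markov bound: nonnegative variables with vanishing means are small in probability. -/
lemma whp_lt_of_isLittleO {Ω : ℕ → Type*} [∀ n, MeasurableSpace (Ω n)] {P : ∀ n, Measure (Ω n)}
    {Z : ∀ n, Ω n → ℝ} {c : ℕ → ℝ} (hZ0 : ∀ n ω, 0 ≤ Z n ω)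
    (hZ : ∀ᶠ n in atTop, Integrable (Z n) (P n)) (hc : ∀ᶠ n in atTop, 0 < c n)
    (h : (fun n => ∫ ω, Z n ω ∂(P n)) =o[atTop] c) {ε : ℝ} (hε : 0 < ε) :
    WHP P fun n ω => Z n ω < ε * c n := by
  have h1 := h.tendsto_div_nhds_zero.div_const ε
  rw [zero_div] at h1
  have h2 := ENNReal.tendsto_ofReal h1
  rw [ENNReal.ofReal_zero] at h2
  refine WHP.of_le h2 ?_
  filter_upwards [hZ, hc] with n hn hcn
  have hpos : 0 < ε * c n := by positivity
  have h3 := meas_ge_le_lintegral_div (μ := P n) (f := fun ω => ENNReal.ofReal (Z n ω))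
    hn.aemeasurable.ennreal_ofReal (ε := ENNReal.ofReal (ε * c n)) (by simpa using hpos)
    ENNReal.ofReal_ne_top
  rw [← ofReal_integral_eq_lintegral_ofReal hn (ae_of_all _ (hZ0 n)),
    ← ENNReal.ofReal_div_of_pos hpos] at h3
  refine (measure_mono fun ω hω => ?_).trans (h3.trans (le_of_eq ?_))
  · exact ENNReal.ofReal_le_ofReal (not_lt.1 hω)
  · rw [div_div, mul_comm ε]

/-- The Lyapunov ratio of a linear combination. -/
lemma lyapunov_linear_le {Ω : Type*} [MeasurableSpace Ω] {P : Measure Ω} [IsProbabilityMeasure P]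
    {N : ℕ} {δ : ℝ} (hδ : 0 < δ) {f g : Ω → ℝ} (hf : MemLp f (ENNReal.ofReal (2 + δ)) P)
    (hg : MemLp g (ENNReal.ofReal (2 + δ)) P) (a b : ℝ) :
    lyapunov P δ N (fun ω => a * f ω + b * g ω) ≤
      (2 * |a|) ^ (2 + δ) * lyapunov P δ N f + (2 * |b|) ^ (2 + δ) * lyapunov P δ N g := by
  have h2 : 0 ≤ 2 + δ := by linarith
  -- From `|x + y| ≤ 2 * max |x| |y|`, with the maximum of the powers bounded by their sum.
  have hpt : ∀ ω, |a * f ω + b * g ω| ^ (2 + δ) ≤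
      (2 * |a|) ^ (2 + δ) * |f ω| ^ (2 + δ) + (2 * |b|) ^ (2 + δ) * |g ω| ^ (2 + δ) := by
    intro ω
    rw [← Real.mul_rpow (by positivity) (abs_nonneg _),
      ← Real.mul_rpow (by positivity) (abs_nonneg _), mul_assoc, mul_assoc, ← abs_mul, ← abs_mul]
    have h := abs_add_le (a * f ω) (b * g ω)
    have p1 : 0 ≤ (2 * |a * f ω|) ^ (2 + δ) := by positivity
    have p2 : 0 ≤ (2 * |b * g ω|) ^ (2 + δ) := by positivity
    rcases le_total |a * f ω| |b * g ω| with hab | hab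
    · have := Real.rpow_le_rpow (abs_nonneg _)
        (by linarith : |a * f ω + b * g ω| ≤ 2 * |b * g ω|) h2
      linarith
    · have := Real.rpow_le_rpow (abs_nonneg _)
        (by linarith : |a * f ω + b * g ω| ≤ 2 * |a * f ω|) h2
      linarith
  have hfi := integrable_abs_rpow hδ hf
  have hgi := integrable_abs_rpow hδ hg
  rw [lyapunov, lyapunov, lyapunov, mul_div_assoc', mul_div_assoc', ← add_div]
  refine div_le_div_of_nonneg_right ?_ (by positivity)
  rw [← integral_const_mul, ← integral_const_mul,
    ← integral_add (hfi.const_mul _) (hgi.const_mul _)]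
  exact integral_mono_of_nonneg (ae_of_all _ fun ω => by positivity)
    ((hfi.const_mul _).add (hgi.const_mul _)) (ae_of_all _ hpt)

/-- The Lyapunov ratio of a standardized variable. -/
lemma lyapunov_standardize {Ω : Type*} [MeasurableSpace Ω] {P : Measure Ω} {N : ℕ} {δ : ℝ}
    {f : Ω → ℝ} :
    lyapunov P δ N (fun ω => (√(∫ ω, f ω ^ 2 ∂P))⁻¹ * f ω) =
      (∫ ω, |f ω| ^ (2 + δ) ∂P) / (∫ ω, f ω ^ 2 ∂P) ^ ((2 + δ) / 2) / (N : ℝ) ^ (δ / 2) := by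
  set v := ∫ ω, f ω ^ 2 ∂P with hv
  have hv0 : 0 ≤ v := integral_nonneg fun _ => sq_nonneg _
  have h1 : ∀ ω, |(√v)⁻¹ * f ω| ^ (2 + δ) = (v ^ ((2 + δ) / 2))⁻¹ * |f ω| ^ (2 + δ) := by
    intro ω
    rw [abs_mul, abs_of_nonneg (by positivity), Real.mul_rpow (by positivity) (abs_nonneg _),
      Real.inv_rpow (Real.sqrt_nonneg _), Real.sqrt_eq_rpow, ← Real.rpow_mul hv0]
    ring_nf
  rw [lyapunov]
  simp_rw [h1]
  rw [integral_const_mul]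
  ring

end

lemma replError_const_mul (N : ℕ) (c : ℝ) (f g : ℕ → ℝ) :
    replError N (fun i => c * f i) (fun i => c * g i) = c ^ 2 * replError N f g := by
  simp only [replError, ← mul_sub, ← Finset.mul_sum, mul_pow]
  ring

end BandedEL

/-! ### Assembly: standardization, then known and unknown means. -/

theorem mainTheorem4
    -- the data of size `n`: i.i.d. random vectors `X n 0, …, X n (n - 1)` in dimension `p n`
    {Ω : ℕ → Type*} [∀ n, MeasurableSpace (Ω n)]
    (P : ∀ n, Measure (Ω n)) [∀ n, IsProbabilityMeasure (P n)]
    (p τ : ℕ → ℕ) (hτ : ∀ n, τ n < p n)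
    (X : ∀ n, ℕ → Ω n → Fin (p n) → ℝ)
    (hmeas : ∀ n, ∀ i < n, Measurable (X n i))
    (hindep : ∀ n, iIndepFun (fun i : Fin n => X n i) (P n))
    (hident : ∀ n, ∀ i < n, IdentDistrib (X n i) (X n 0) (P n) (P n))
    -- with mean `μ n` and covariance matrix `S n`
    (μ : ∀ n, Fin (p n) → ℝ) (S : ∀ n, Matrix (Fin (p n)) (Fin (p n)) ℝ)
    (hL2 : ∀ n, ∀ i < n, ∀ a, MemLp (fun ω => X n i ω a) 2 (P n))
    (hmean : ∀ n, ∀ i < n, ∀ a, ∫ ω, X n i ω a ∂(P n) = μ n a)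
    (hcov : ∀ n, ∀ i < n, ∀ a b,
      cov[fun ω => X n i ω a, fun ω => X n i ω b; P n] = S n a b)
    -- the half sample size and the statistics at the true covariance matrix
    (N : ℕ → ℕ) (hN : ∀ n, N n = n / 2)
    (e' v' e_star v_star : ∀ n, ℕ → Ω n → ℝ)
    (he : ∀ n i ω, e' n i ω = BandedEL.eKnown (N n) (τ n) (μ n) (S n) (fun k => X n k ω) i)
    (hv : ∀ n i ω, v' n i ω = BandedEL.vKnown (N n) (τ n) (μ n) (S n) (fun k => X n k ω) i)
    (he_star : ∀ n i ω, e_star n i ω = BandedEL.eStar (N n) (τ n) (S n) (fun k => X n k ω) i)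
    (hv_star : ∀ n i ω, v_star n i ω = BandedEL.vStar (N n) (τ n) (S n) (fun k => X n k ω) i)
    -- the moment conditions; the moments involved are finite for large `n`
    (hpos : ∀ᶠ n in atTop, 0 < ∫ ω, v' n 0 ω ^ 2 ∂(P n))
    (δ : ℝ) (hδ : 0 < δ)
    (heLp : ∀ᶠ n in atTop, MemLp (e' n 0) (ENNReal.ofReal (2 + δ)) (P n))
    (hvLp : ∀ᶠ n in atTop, MemLp (v' n 0) (ENNReal.ofReal (2 + δ)) (P n))
    (hratio : (fun n => max
        ((∫ ω, |e' n 0 ω| ^ (2 + δ) ∂(P n)) / (∫ ω, e' n 0 ω ^ 2 ∂(P n)) ^ ((2 + δ) / 2))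
        ((∫ ω, |v' n 0 ω| ^ (2 + δ) ∂(P n)) / (∫ ω, v' n 0 ω ^ 2 ∂(P n)) ^ ((2 + δ) / 2)))
      =o[atTop] fun n => (N n : ℝ) ^ ((δ + min 2 δ) / 4))
    -- the null hypothesis
    (hH0 : ∀ n, ∀ a b : Fin (p n), (τ n : ℤ) ≤ |(a : ℤ) - (b : ℤ)| → S n a b = 0)
    -- the matrix at which the tests are evaluated
    (S₀ : ∀ n, Matrix (Fin (p n)) (Fin (p n)) ℝ)
    (hS₀ : ∀ n, BandedEL.offBand (τ n) (S₀ n) = 0) :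
    TendstoInDistribution
        (fun n ω => BandedEL.negTwoLog
          (BandedEL.L₃ (N n) (τ n) (μ n) (S₀ n) fun k => X n k ω))
        atTop (fun t : ℝ => (t : EReal)) P (BandedEL.chiSq 2) ∧
    ((∀ᶠ n in atTop, Integrable (fun ω =>
          BandedEL.replError (N n) (fun i => e' n i ω) (fun i => e_star n i ω)) (P n)) →
      (∀ᶠ n in atTop, Integrable (fun ω =>
          BandedEL.replError (N n) (fun i => v' n i ω) (fun i => v_star n i ω)) (P n)) →
      ((fun n => ∫ ω, BandedEL.replError (N n) (fun i => e' n i ω) (fun i => e_star n i ω) ∂(P n))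
        =o[atTop] fun n => (N n : ℝ) * ∫ ω, e' n 0 ω ^ 2 ∂(P n)) →
      ((fun n => ∫ ω, BandedEL.replError (N n) (fun i => v' n i ω) (fun i => v_star n i ω) ∂(P n))
        =o[atTop] fun n => (N n : ℝ) * ∫ ω, v' n 0 ω ^ 2 ∂(P n)) →
      TendstoInDistribution
        (fun n ω => BandedEL.negTwoLog
          (BandedEL.L₄ (N n) (τ n) (S₀ n) fun k => X n k ω))
        atTop (fun t : ℝ => (t : EReal)) P (BandedEL.chiSq 2)) := by
  have hNtop : Tendsto N atTop atTop := by
    simp_rw [funext hN]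
    exact Nat.tendsto_div_const_atTop two_ne_zero
  have h2N : ∀ n, 2 * N n ≤ n := fun n => by rw [hN]; omega
  have hoff : ∀ n, BandedEL.offBand (τ n) (S₀ n) = BandedEL.offBand (τ n) (S n) := fun n => by
    rw [hS₀, BandedEL.offBand_eq_zero (hH0 n)]
  have hoffS : ∀ n, BandedEL.offBand (τ n) (S n) = 0 := fun n => BandedEL.offBand_eq_zero (hH0 n)
  -- the statistics as functions of independent pairs
  let φ : ∀ n, (Fin (p n) → ℝ) × (Fin (p n) → ℝ) → ℝ := fun n z =>
    ∑ k, BandedEL.offBandEntry (τ n) (μ n) k z.1 * BandedEL.offBandEntry (τ n) (μ n) k z.2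
  let ψ : ∀ n, (Fin (p n) → ℝ) × (Fin (p n) → ℝ) → ℝ := fun n z =>
    ∑ k, BandedEL.offBandEntry (τ n) (μ n) k z.1 + ∑ k, BandedEL.offBandEntry (τ n) (μ n) k z.2
  have hentry : ∀ n k, Measurable (BandedEL.offBandEntry (τ n) (μ n) k) := fun n k =>
    BandedEL.measurable_offBandEntry measurable_const measurable_id k
  have hφm : ∀ n, Measurable (φ n) := fun n => by fun_prop
  have hψm : ∀ n, Measurable (ψ n) := fun n => by fun_prop
  have heφ : ∀ n i ω, e' n i ω = φ n (X n i ω, X n (N n + i) ω) := fun n i ω => by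
    rw [he, BandedEL.eKnown_eq _ _ _ (hoffS n)]
  have hvψ : ∀ n i ω, v' n i ω = ψ n (X n i ω, X n (N n + i) ω) := fun n i ω => by
    rw [hv, BandedEL.vKnown_eq _ _ _ (hoffS n)]
  have hpair : ∀ n, ∀ i < N n, Measurable fun ω => (X n i ω, X n (N n + i) ω) := fun n i hi =>
    (hmeas n i (by have := h2N n; omega)).prodMk (hmeas n _ (by have := h2N n; omega))
  have hem : ∀ n, ∀ i < N n, AEMeasurable (e' n i) (P n) := fun n i hi => by
    rw [funext (heφ n i)]; exact ((hφm n).comp (hpair n i hi)).aemeasurable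
  have hvm : ∀ n, ∀ i < N n, AEMeasurable (v' n i) (P n) := fun n i hi => by
    rw [funext (hvψ n i)]; exact ((hψm n).comp (hpair n i hi)).aemeasurable
  have hesm : ∀ n, ∀ i < N n, AEMeasurable (e_star n i) (P n) := fun n i hi => by
    rw [funext (he_star n i)]
    exact (BandedEL.measurable_eStar
      (fun j hj => hmeas n j (hj.trans_le (h2N n))) hi).aemeasurable
  have hvsm : ∀ n, ∀ i < N n, AEMeasurable (v_star n i) (P n) := fun n i hi => by
    rw [funext (hv_star n i)]
    exact (BandedEL.measurable_vStar
      (fun j hj => hmeas n j (hj.trans_le (h2N n))) hi).aemeasurable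
  -- moments
  have hmom : ∀ᶠ n in atTop, ∫ ω, e' n 0 ω ∂(P n) = 0 ∧ ∫ ω, v' n 0 ω ∂(P n) = 0 ∧
      ∫ ω, e' n 0 ω * v' n 0 ω ∂(P n) = 0 ∧ 0 < ∫ ω, e' n 0 ω ^ 2 ∂(P n) := by
    filter_upwards [hNtop.eventually_gt_atTop 0, hpos, heLp, hvLp] with n h1 h2 h3 h4
    have h0 : 0 < n := by have := h2N n; omega
    exact BandedEL.moments_eKnown_vKnown (hmeas n) (hindep n) (hident n) h1 (h2N n)
      (hL2 n 0 h0) (hmean n 0 h0) (hcov n 0 h0) (hH0 n) (funext (he n 0)) (funext (hv n 0))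
      (BandedEL.memLp_two_of_memLp hδ h3) (BandedEL.memLp_two_of_memLp hδ h4) h2
  -- standardized statistics
  let σe : ℕ → ℝ := fun n => (√(∫ ω, e' n 0 ω ^ 2 ∂(P n)))⁻¹
  let σv : ℕ → ℝ := fun n => (√(∫ ω, v' n 0 ω ^ 2 ∂(P n)))⁻¹
  have hσ : ∀ᶠ n in atTop, 0 < σe n ∧ 0 < σv n := by
    filter_upwards [hmom, hpos] with n h1 h2
    exact ⟨inv_pos.2 (Real.sqrt_pos.2 h1.2.2.2), inv_pos.2 (Real.sqrt_pos.2 h2)⟩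
  have hlyap : Tendsto (fun n => (max
      ((∫ ω, |e' n 0 ω| ^ (2 + δ) ∂(P n)) / (∫ ω, e' n 0 ω ^ 2 ∂(P n)) ^ ((2 + δ) / 2))
      ((∫ ω, |v' n 0 ω| ^ (2 + δ) ∂(P n)) / (∫ ω, v' n 0 ω ^ 2 ∂(P n)) ^ ((2 + δ) / 2)))
      / (N n : ℝ) ^ (δ / 2)) atTop (𝓝 0) := by
    -- The rate in the hypothesis has exponent `(δ + min 2 δ) / 4 ≤ δ / 2`, so it implies Lyapunov's
    -- condition.
    refine (hratio.trans_isBigO ?_).tendsto_div_nhds_zero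
    refine IsBigO.of_bound 1 ?_
    filter_upwards [hNtop.eventually_gt_atTop 0] with n hn
    have h1 : (1 : ℝ) ≤ N n := by exact_mod_cast hn
    rw [Real.norm_of_nonneg (by positivity), Real.norm_of_nonneg (by positivity), one_mul]
    exact Real.rpow_le_rpow_of_exponent_le h1 (by linarith [min_le_right 2 δ])
  have hlyape : Tendsto (fun n => BandedEL.lyapunov (P n) δ (N n) fun ω => σe n * e' n 0 ω)
      atTop (𝓝 0) := by
    refine squeeze_zero (fun _ => BandedEL.lyapunov_nonneg) (fun n => ?_) hlyap
    rw [BandedEL.lyapunov_standardize]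
    exact div_le_div_of_nonneg_right (le_max_left _ _) (by positivity)
  have hlyapv : Tendsto (fun n => BandedEL.lyapunov (P n) δ (N n) fun ω => σv n * v' n 0 ω)
      atTop (𝓝 0) := by
    refine squeeze_zero (fun _ => BandedEL.lyapunov_nonneg) (fun n => ?_) hlyap
    rw [BandedEL.lyapunov_standardize]
    exact div_le_div_of_nonneg_right (le_max_right _ _) (by positivity)
  -- The variance is `a ^ 2 + b ^ 2` because the standardized coordinates are uncorrelated with unit
  -- variance.
  have hlin : ∀ a b : ℝ, BandedEL.LyapunovArray P N δ (a ^ 2 + b ^ 2) fun n i ω =>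
      a * (σe n * e' n i ω) + b * (σv n * v' n i ω) := by
    intro a b
    let F : ∀ n, (Fin (p n) → ℝ) × (Fin (p n) → ℝ) → ℝ := fun n z =>
      a * (σe n * φ n z) + b * (σv n * ψ n z)
    have hF : ∀ n, Measurable (F n) := fun n => by fun_prop
    have hFe : ∀ n i, (fun ω => a * (σe n * e' n i ω) + b * (σv n * v' n i ω)) =
        fun ω => F n (X n i ω, X n (N n + i) ω) := fun n i => by
      ext ω; rw [heφ, hvψ]
    refine ⟨?_, ?_, ?_, ?_, ?_, ?_⟩
    · refine Eventually.of_forall fun n i hi => ?_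
      have h0 : 0 < N n := by omega
      rw [hFe, hFe]
      refine IdentDistrib.comp (u := F n) ⟨(hpair n i hi).aemeasurable, (hpair n 0 h0).aemeasurable,
        ?_⟩ (hF n)
      rw [BandedEL.map_pair (hmeas n) (hindep n) (hident n) (h2N n) hi,
        BandedEL.map_pair (hmeas n) (hindep n) (hident n) (h2N n) h0]
    · refine Eventually.of_forall fun n => ?_
      have h := (BandedEL.iIndepFun_pairs (hmeas n) (hindep n) (h2N n)).comp (fun _ => F n)
        fun _ => hF n
      exact (funext fun i : Fin (N n) => hFe n i) ▸ h
    · filter_upwards [heLp, hvLp] with n h1 h2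
      exact ((h1.const_mul _).const_mul _).add ((h2.const_mul _).const_mul _)
    · filter_upwards [heLp, hvLp, hmom] with n h1 h2 h3
      have i1 := (BandedEL.memLp_two_of_memLp hδ h1).integrable (by norm_num)
      have i2 := (BandedEL.memLp_two_of_memLp hδ h2).integrable (by norm_num)
      rw [integral_add ((i1.const_mul _).const_mul _) ((i2.const_mul _).const_mul _)]
      simp only [integral_const_mul, h3.1, h3.2.1, mul_zero, add_zero]
    · filter_upwards [heLp, hvLp, hmom, hpos] with n h1 h2 h3 h4
      have m1 := BandedEL.memLp_two_of_memLp hδ h1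
      have m2 := BandedEL.memLp_two_of_memLp hδ h2
      have i3 : Integrable (fun ω => e' n 0 ω * v' n 0 ω) (P n) := m1.integrable_mul m2
      have hexp : ∀ ω, (a * (σe n * e' n 0 ω) + b * (σv n * v' n 0 ω)) ^ 2 =
          a ^ 2 * σe n ^ 2 * e' n 0 ω ^ 2 + b ^ 2 * σv n ^ 2 * v' n 0 ω ^ 2 +
            2 * a * b * σe n * σv n * (e' n 0 ω * v' n 0 ω) := fun ω => by ring
      simp_rw [hexp]
      have i12 : Integrable (fun ω => a ^ 2 * σe n ^ 2 * e' n 0 ω ^ 2 +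
          b ^ 2 * σv n ^ 2 * v' n 0 ω ^ 2) (P n) :=
        (m1.integrable_sq.const_mul _).add (m2.integrable_sq.const_mul _)
      rw [integral_add i12 (i3.const_mul _), integral_add (m1.integrable_sq.const_mul _)
        (m2.integrable_sq.const_mul _), integral_const_mul, integral_const_mul,
        integral_const_mul, h3.2.2.1]
      have e1 : σe n ^ 2 = (∫ ω, e' n 0 ω ^ 2 ∂(P n))⁻¹ := by
        simp only [σe]; rw [inv_pow, Real.sq_sqrt h3.2.2.2.le]
      have e2 : σv n ^ 2 = (∫ ω, v' n 0 ω ^ 2 ∂(P n))⁻¹ := by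
        simp only [σv]; rw [inv_pow, Real.sq_sqrt h4.le]
      rw [e1, e2, mul_assoc, mul_assoc, inv_mul_cancel₀ h3.2.2.2.ne', inv_mul_cancel₀ h4.ne']
      ring
    · have hlim := (hlyape.const_mul ((2 * |a|) ^ (2 + δ))).add
        (hlyapv.const_mul ((2 * |b|) ^ (2 + δ)))
      rw [mul_zero, mul_zero, add_zero] at hlim
      refine tendsto_of_tendsto_of_tendsto_of_le_of_le' tendsto_const_nhds hlim
        (Eventually.of_forall fun _ => BandedEL.lyapunov_nonneg) ?_
      filter_upwards [heLp, hvLp] with n h1 h2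
      exact BandedEL.lyapunov_linear_le hδ (h1.const_mul _) (h2.const_mul _) a b
  have hstd : BandedEL.StandardArray P N (fun n i ω => σe n * e' n i ω)
      (fun n i ω => σv n * v' n i ω) :=
    BandedEL.StandardArray.of_lyapunovArray hNtop hδ (fun n i hi => (hem n i hi).const_mul _)
      (fun n i hi => (hvm n i hi).const_mul _) hlin
  -- the likelihood ratio does not depend on the scale of the statistics
  have hscale : ∀ {u w : ∀ n, ℕ → Ω n → ℝ}, (∀ n, ∀ i < N n, AEMeasurable (u n i) (P n)) →
      (∀ n, ∀ i < N n, AEMeasurable (w n i) (P n)) →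
      BandedEL.StandardArray P N (fun n i ω => σe n * u n i ω) (fun n i ω => σv n * w n i ω) →
      TendstoInDistribution (fun n ω => BandedEL.negTwoLog
        (BandedEL.elRatio (N n) (fun i => u n i ω) (fun i => w n i ω)))
        atTop (fun t : ℝ => (t : EReal)) P (BandedEL.chiSq 2) := by
    intro u w hu hw H
    refine BandedEL.tendstoInDistribution_of_whp_eq
      (H.tendstoInDistribution_negTwoLog_elRatio hNtop)
      (fun n => BandedEL.aemeasurable_negTwoLog_elRatio (hu n) (hw n)) ?_
    -- For small `n` a scale may be zero, where rescaling is not invertible; the two statistics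
    -- agree only eventually.
    refine BandedEL.WHP.of_le (u := fun _ => 0) tendsto_const_nhds ?_
    filter_upwards [hσ] with n hn
    simp only [BandedEL.elRatio_const_mul hn.1.ne' hn.2.ne', not_true_eq_false]
    simp
  constructor
  · have h := hscale hem hvm hstd
    have hfun : ∀ n ω, BandedEL.L₃ (N n) (τ n) (μ n) (S₀ n) (fun k => X n k ω) =
        BandedEL.elRatio (N n) (fun i => e' n i ω) (fun i => v' n i ω) := fun n ω =>
      BandedEL.elRatio_congr (fun i _ => by rw [he, BandedEL.eKnown_congr (hoff n)])
        fun i _ => by rw [hv, BandedEL.vKnown_congr (hoff n)]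
    simp_rw [hfun]
    exact h
  · intro hie hiv hoe hov
    have herr : ∀ {u w : ∀ n, ℕ → Ω n → ℝ}, (∀ᶠ n in atTop, 0 < ∫ ω, u n 0 ω ^ 2 ∂(P n)) →
        (∀ᶠ n in atTop, Integrable (fun ω =>
          BandedEL.replError (N n) (fun i => u n i ω) (fun i => w n i ω)) (P n)) →
        ((fun n => ∫ ω, BandedEL.replError (N n) (fun i => u n i ω) (fun i => w n i ω) ∂(P n))
          =o[atTop] fun n => (N n : ℝ) * ∫ ω, u n 0 ω ^ 2 ∂(P n)) → ∀ ε > 0,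
        BandedEL.WHP P fun n ω => BandedEL.replError (N n)
          (fun i => (√(∫ ω, u n 0 ω ^ 2 ∂(P n)))⁻¹ * u n i ω)
          (fun i => (√(∫ ω, u n 0 ω ^ 2 ∂(P n)))⁻¹ * w n i ω) < ε * N n := by
      intro u w hu hi ho ε hε
      have hNpos := hNtop.eventually_gt_atTop 0
      have h1 := BandedEL.whp_lt_of_isLittleO
        (fun n ω => by rw [BandedEL.replError]; positivity) hi
        ((hu.and hNpos).mono fun n hn => mul_pos (by exact_mod_cast hn.2) hn.1) ho hε
      refine h1.mono ?_
      filter_upwards [hu] with n hn ω hω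
      -- The error is quadratic in the scale, so standardizing removes exactly the second moment
      -- from the bound.
      rw [BandedEL.replError_const_mul, inv_pow, Real.sq_sqrt hn.le, inv_mul_lt_iff₀ hn]
      linarith
    have hpose : ∀ᶠ n in atTop, 0 < ∫ ω, e' n 0 ω ^ 2 ∂(P n) := hmom.mono fun n hn => hn.2.2.2
    have h := hscale hesm hvsm (hstd.of_replError hNtop
      (fun n i hi => (hesm n i hi).const_mul _) (fun n i hi => (hvsm n i hi).const_mul _)
      (herr hpose hie hoe) (herr hpos hiv hov))
    have hfun : ∀ n ω, BandedEL.L₄ (N n) (τ n) (S₀ n) (fun k => X n k ω) =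
        BandedEL.elRatio (N n) (fun i => e_star n i ω) (fun i => v_star n i ω) := fun n ω =>
      BandedEL.elRatio_congr (fun i _ => by rw [he_star, BandedEL.eStar_congr (hoff n)])
        fun i _ => by rw [hv_star, BandedEL.vStar_congr (hoff n)]
    simp_rw [hfun]
    exact h
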